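/- Let $p_n$ denote the $n$-th prime and let $k\ge 1$ be an integer. For real $x$ and a set $\mathcal D=\{d_1<\dots<d_k\}$ of $k$ distinct integers, let $N_k(x,\mathcal D)$ be the number of $n\ge 1$ with $p_{n+k}\le x$ and $p_{n+i}-p_n=d_i$ for $1\le i\le k$. A set $\mathcal D$ of $k$ distinct integers is a $k$-tuple jumping champion for $x$ if $N_k(x,\mathcal D)=N_k^*(x):=\max_{\mathcal E}N_k(x,\mathcal E)$, the maximum being over all sets $\mathcal E$ of $k$ distinct integers. For a finite set $\mathcal E$ of $n$ integers, let $\pi_n(x,\mathcal E)$ be the number of positive integers $m\le x$ such that $m+e$ is prime for every $e\in\mathcal E$, let $\nu_{\mathcal E}(p)$ be the number of residue classes modulo $p$ occupied by elements of $\mathcal E$, and let $$\mathfrak S(\mathcal E)=\prod_p\Big(1-\frac1p\Big)^{-n}\Big(1-\frac{\nu_{\mathcal E}(p)}{p}\Big),$$ the product being over all primes $p$. **Theorem.** Let $k\ge1$. Assume the following uniform Hardy–Littlewood prime $(k+1)$-tuple conjecture (for this $k$): as $x\to\infty$, $$\pi_{k+1}(x,\{0\}\cup\mathcal D)=\mathfrak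 S(\{0\}\cup\mathcal D)\frac{x}{\log^{k+1}x}\,(1+o(1))$$ uniformly over all sets $\mathcal D\subset[2,\log^{k+1}x]$ of $k$ distinct integers with $\mathfrak S(\{0\}\cup\mathcal D)\ne0$. Then the following hold. 1. The greatest common divisor of the elements of the $k$-tuple jumping champions tends to infinity: for every $M$ there is $X$ such that for all $x\ge X$, every $k$-tuple jumping champion $\mathcal D$ for $x$ satisfies $\gcd(\mathcal D)\ge M$. 2. Every fixed prime $p$ divides every element of all sufficiently large $k$-tuple jumping champions. That is, there is $X$ such that for all $x\ge X$, $p$ divides every element of every $k$-tuple jumping champion for $x$; also, there is $C$ such that for every real $x$ with $N_k^*(x)>0$ and every $k$-tuple jumping champion $\mathcal D$ for $x$ with $\max\mathcal D\ge C$, $p$ divides every element of $\mathcal D$. -/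

import Mathlib

open Filter

namespace JumpingChampion

/-- `N_k(x, D)` for a set `D = {d_1 < ... < d_k}` of integers: the number of `n` with `p_{n+k} ≤ x`
and `p_{n+i} - p_n = d_i` for `1 ≤ i ≤ k`.  As `p_{n+1} - p_n < ... < p_{n+k} - p_n`, the last
condition says that the set of these differences is `D`.  Here `Nat.nth Nat.Prime` enumerates all
primes increasingly (from index `0`). -/
noncomputable def gapCount (k : ℕ) (x : ℝ) (D : Finset ℤ) : ℕ :=
  Set.ncard {n : ℕ | (Nat.nth Nat.Prime (n + k) : ℝ) ≤ x ∧
    (Finset.Icc 1 k).image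
      (fun i => (Nat.nth Nat.Prime (n + i) : ℤ) - (Nat.nth Nat.Prime n : ℤ)) = D}

/-- `D` is a `k`-tuple jumping champion for `x`: among all sets of `k` distinct integers it
maximizes `N_k(x, ·)`. -/
def IsChampion (k : ℕ) (x : ℝ) (D : Finset ℤ) : Prop :=
  D.card = k ∧ ∀ E : Finset ℤ, E.card = k → gapCount k x E ≤ gapCount k x D

/-- `π_n(x, D)`, `n = #D`: the number of positive integers `m ≤ x` such that `m + d` is a (positive)
prime for every `d ∈ D`. (A negative integer has `toNat` equal to `0`, which is not prime.) -/
noncomputable def primeTupleCount (x : ℝ) (D : Finset ℤ) : ℕ :=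
  Set.ncard {m : ℕ | 0 < m ∧ (m : ℝ) ≤ x ∧ ∀ d ∈ D, Nat.Prime ((m : ℤ) + d).toNat}

/-- `ν_D(p)`: the number of distinct residue classes modulo `p` occupied by elements of `D`. -/
def residueCount (D : Finset ℤ) (p : ℕ) : ℕ :=
  (D.image (fun d : ℤ => (d : ZMod p))).card

/-- The singular series `𝔖(D) = ∏_p (1 - 1/p)^{-n} (1 - ν_D(p)/p)`, `n = #D`. -/
noncomputable def singularSeries (D : Finset ℤ) : ℝ :=
  ∏' p : Nat.Primes,
    ((1 - 1 / ((p : ℕ) : ℝ)) ^ D.card)⁻¹ * (1 - (residueCount D p : ℝ) / ((p : ℕ) : ℝ))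

/-- The Hardy–Littlewood prime `(k+1)`-tuple conjecture, uniformly for `D ⊂ [2, log^{k+1} x]`:
as `x → ∞`, `π_{k+1}(x, {0} ∪ D) = 𝔖({0} ∪ D) x / log^{k+1} x (1 + o(1))`, with `o(1)` uniform over
the sets `D` of `k` distinct integers in `[2, log^{k+1} x]` with `𝔖({0} ∪ D) ≠ 0`. -/
def UniformHardyLittlewood (k : ℕ) : Prop :=
  ∀ ε : ℝ, 0 < ε → ∀ᶠ x : ℝ in atTop, ∀ D : Finset ℤ, D.card = k →
    (∀ d ∈ D, 2 ≤ d ∧ (d : ℝ) ≤ Real.log x ^ (k + 1)) →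
    singularSeries (insert 0 D) ≠ 0 →
    |(primeTupleCount x (insert 0 D) : ℝ) -
        singularSeries (insert 0 D) * (x / Real.log x ^ (k + 1))| ≤
      ε * (singularSeries (insert 0 D) * (x / Real.log x ^ (k + 1)))

end JumpingChampion

/-!
The prime tuple conjecture bounds the number of occurrences of a difference pattern `D` from above
by about `𝔖({0} ∪ D) X`, where `X = x / log ^ (k + 1) x`. So a champion must have a singular
series which is asymptotically as large as that of any pattern whose conjectural count of prime
tuples comes almost entirely from consecutive primes.

The competitor is `D₀ = {P, 2P, …, kP}`, with `P` the primorial of `y`, a small multiple of `log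
log x`. Then `k P ≤ log ^ c x` for a small `c > 0` (as `P ≤ 4 ^ y`), and almost all prime tuples
of shape `{0} ∪ D₀` consist of consecutive primes (`eventually_gapCount_multiples_ge`): otherwise
there is a further prime at a distance `e ≤ k P`, and the number of these `(k + 2)`-tuples is
bounded unconditionally. Because `k P` is so small, a sieve which loses a small power of `log x`
suffices here, and the inclusion-exclusion truncated after `O(log log x)` steps is enough
(`card_sifted_le`, `eventually_primeTupleCount_mul_le`).

Now let `D` be a champion. The differences `p_{n+k} - p_n` have sum at most `k x`, hence `D` would
occur at most `k X` times if it had an element beyond `log ^ (k + 1) x` (`gapCount_mul_le`), while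
`𝔖({0} ∪ D₀)` tends to infinity with `y`. So the conjecture applies to `D`. Compare the singular
series of `{0} ∪ D` and `{0} ∪ D₀` prime by prime (`singularSeries_le_of_not_dvd`). At the primes
up to `y` the set `{0} ∪ D₀` occupies a single class, so its factor is the largest possible one;
at a prime `p` which does not divide all elements of `D` it is larger than that of `{0} ∪ D` by
`(p - 1) / (p - 2)` at least (for `p = 2` the latter vanishes). The factors beyond `y` of `{0} ∪
D` exceed those of `{0} ∪ D₀` only at primes dividing a difference of two elements. There are
`O(log log x / log y) = O(y / log y)` of them, and each gains a factor `1 + O(1 / y)`, which is `1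
+ o(1)` in total. Hence `𝔖({0} ∪ D) ≤ (1 + o(1)) (p - 2) / (p - 1) 𝔖({0} ∪ D₀)`, which a champion
cannot satisfy.

The statement on the greatest common divisor follows by taking a prime `p ≥ M`, and the statement
on champions with a large element because this element is at most `x`.
-/

namespace JumpingChampion

/-! ### Brun's pure sieve -/

/-- Bonferroni's inequality: inclusion-exclusion truncated after an even number `R` of steps
overcounts. -/
theorem bonferroni {ι : Type*} [DecidableEq ι] (F : Finset ι) {R : ℕ} (hR : Even R) :
    (if F = ∅ then 1 else 0 : ℝ) ≤ ∑ S ∈ F.powerset with S.card ≤ R, (-1 : ℝ) ^ S.card := by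
  have key : ∑ S ∈ F.powerset with S.card ≤ R, (-1 : ℝ) ^ S.card
      = ((∑ i ∈ Finset.range (R + 1), ((-1) ^ i * (F.card.choose i : ℤ)) : ℤ) : ℝ) := by
    have : ∀ S ∈ F.powerset.filter (fun S => S.card ≤ R), S.card ∈ Finset.range (R + 1) := by
      intro S hS
      have := (Finset.mem_filter.1 hS).2
      simp; omega
    rw [← Finset.sum_fiberwise_of_maps_to this]
    push_cast
    refine Finset.sum_congr rfl fun i hi => ?_
    have hi' : i ≤ R := by simpa [Nat.lt_succ_iff] using hi
    have h1 : (F.powerset.filter (fun S => S.card ≤ R)).filter (fun S => S.card = i)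
        = F.powersetCard i := by
      ext S
      simp only [Finset.mem_filter, Finset.mem_powerset, Finset.mem_powersetCard]
      constructor
      · rintro ⟨⟨a, _⟩, b⟩; exact ⟨a, b⟩
      · rintro ⟨a, b⟩; exact ⟨⟨a, by omega⟩, b⟩
    rw [h1, Finset.sum_congr rfl (fun S hS => by rw [(Finset.mem_powersetCard.1 hS).2]),
      Finset.sum_const, Finset.card_powersetCard, nsmul_eq_mul, mul_comm]
  rw [key]
  split_ifs with h
  · subst h
    rw [Finset.sum_eq_single 0 (fun i _ hi => by
      simp [Nat.choose_eq_zero_of_lt (Nat.pos_of_ne_zero hi)])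
      (by simp)]
    simp
  · obtain ⟨n, hn⟩ := Nat.exists_eq_succ_of_ne_zero (Finset.card_ne_zero.2
      (Finset.nonempty_iff_ne_empty.2 h))
    rw [hn, Nat.succ_eq_add_one, Int.alternating_sum_range_choose_eq_choose, hR.neg_one_pow]
    positivity

/-- The integers below `N` are equidistributed modulo `M`, with an error of at most `1` for each
residue class. -/
theorem abs_card_natCast_mem_sub_le {M : ℕ} [NeZero M] (N : ℕ) (B : Finset (ZMod M)) :
    |(((Finset.range N).filter (fun m : ℕ => (m : ZMod M) ∈ B)).card : ℝ) - N * (B.card / M)|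
      ≤ B.card := by
  have hM : (0 : ℝ) < M := by exact_mod_cast NeZero.pos M
  have h1 : ((Finset.range N).filter (fun m : ℕ => (m : ZMod M) ∈ B)).card
      = ∑ b ∈ B, ((Finset.range N).filter (fun m : ℕ => (m : ZMod M) = b)).card := by
    rw [Finset.card_eq_sum_card_fiberwise (f := fun m : ℕ => (m : ZMod M)) (t := B)
      (by intro m hm; exact (Finset.mem_filter.1 hm).2)]
    refine Finset.sum_congr rfl fun b hb => ?_
    congr 1
    ext m
    simp only [Finset.mem_filter]
    constructor
    · rintro ⟨⟨a, _⟩, c⟩; exact ⟨a, c⟩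
    · rintro ⟨a, c⟩; exact ⟨⟨a, c ▸ hb⟩, c⟩
  have h2 : ∀ b : ZMod M,
      |(((Finset.range N).filter (fun m : ℕ => (m : ZMod M) = b)).card : ℝ) - N / M| ≤ 1 := by
    intro b
    have h3 : ((Finset.range N).filter (fun m : ℕ => (m : ZMod M) = b)).card
        = N / M + if b.val % M < N % M then 1 else 0 := by
      rw [← Nat.count_modEq_card N (NeZero.pos M) b.val, Nat.count_eq_card_filter_range]
      congr 1
      ext m
      simp only [Finset.mem_filter, ← ZMod.natCast_eq_natCast_iff, ZMod.natCast_val, ZMod.cast_id',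
        id]
    rw [h3]
    have h4 : ((N / M : ℕ) : ℝ) ≤ N / M := Nat.cast_div_le
    have h5 : (N : ℝ) / M < (N / M : ℕ) + 1 := by
      rw [div_lt_iff₀ hM]
      have := Nat.lt_div_mul_add (a := N) (NeZero.pos M)
      have h6 : N < (N / M + 1) * M := by rw [add_mul, one_mul]; exact this
      exact_mod_cast h6
    rw [abs_le]
    split_ifs <;> constructor <;> push_cast <;> linarith
  rw [h1]
  have h7 : ((∑ b ∈ B, ((Finset.range N).filter (fun m : ℕ => (m : ZMod M) = b)).card : ℕ) : ℝ)
      - N * (B.card / M) = ∑ b ∈ B,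
      ((((Finset.range N).filter (fun m : ℕ => (m : ZMod M) = b)).card : ℝ) - N / M) := by
    rw [Finset.sum_sub_distrib, Finset.sum_const, nsmul_eq_mul]
    push_cast
    ring
  rw [h7]
  refine (Finset.abs_sum_le_sum_abs _ _).trans ?_
  refine (Finset.sum_le_sum fun b _ => h2 b).trans ?_
  simp

/-- By the Chinese remainder theorem, prescribing residue classes modulo distinct primes gives
independent conditions. -/
theorem abs_card_forall_natCast_mem_sub_le (S : Finset ℕ) (hS : ∀ q ∈ S, q.Prime)
    (A : (q : ℕ) → Finset (ZMod q)) (N : ℕ) :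
    |(((Finset.range N).filter (fun m : ℕ => ∀ q ∈ S, (m : ZMod q) ∈ A q)).card : ℝ)
      - N * ∏ q ∈ S, ((A q).card / q : ℝ)| ≤ ∏ q ∈ S, ((A q).card : ℝ) := by
  classical
  have hpos : ∀ q : S, 0 < (q : ℕ) := fun q => (hS q q.2).pos
  let a : S → ℕ := fun q => q
  have hcop : Pairwise (Function.onFun Nat.Coprime a) := by
    intro i j hij
    exact (Nat.coprime_primes (hS i i.2) (hS j j.2)).2 (fun h => hij (Subtype.ext h))
  have : NeZero (∏ i, a i) := ⟨Finset.prod_ne_zero_iff.2 fun i _ => (hpos i).ne'⟩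
  let e := ZMod.prodEquivPi a hcop
  have : ∀ i : S, NeZero (a i) := fun i => ⟨(hpos i).ne'⟩
  let B : Finset (ZMod (∏ i, a i)) :=
    (Fintype.piFinset (fun i : S => A (a i))).map e.symm.toEquiv.toEmbedding
  have hB : B.card = ∏ q ∈ S, (A q).card := by
    rw [Finset.card_map, Fintype.card_piFinset, ← Finset.prod_coe_sort S (fun q => (A q).card)]
  have hM : ∏ i, a i = ∏ q ∈ S, q := Finset.prod_coe_sort S (fun q => q)
  have hmem : ∀ m : ℕ, (m : ZMod (∏ i, a i)) ∈ B ↔ ∀ q ∈ S, (m : ZMod q) ∈ A q := by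
    intro m
    have : ((m : ZMod (∏ i, a i)) ∈ B) ↔
        e (m : ZMod (∏ i, a i)) ∈ Fintype.piFinset (fun i : S => A (a i)) := by
      simp only [B, Finset.mem_map_equiv]
      rfl
    rw [this, map_natCast, Fintype.mem_piFinset]
    simp [a]
  have := abs_card_natCast_mem_sub_le N B
  simp only [hmem, hB] at this
  rw [Finset.prod_div_distrib]
  rw [hM] at this
  push_cast at this
  exact this

/-- Brun's pure sieve: the number of integers below `N` avoiding `κ` residue classes modulo each
prime of `Q`, for a truncation after `R` steps. The second product bounds the part of the main term
lost by truncating, and the last term bounds the accumulated rounding errors; `t` is free. -/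
theorem card_sifted_le (Q : Finset ℕ) (hQ : ∀ q ∈ Q, q.Prime) (A : (q : ℕ) → Finset (ZMod q))
    {κ : ℕ} (hA : ∀ q ∈ Q, (A q).card = κ) (N : ℕ) {R : ℕ} (hR : Even R) {t : ℝ} (ht : 1 ≤ t) :
    (((Finset.range N).filter (fun m : ℕ => ∀ q ∈ Q, (m : ZMod q) ∉ A q)).card : ℝ) ≤
      N * (∏ q ∈ Q, (1 - κ / q : ℝ) + (1 / 2) ^ R * ∏ q ∈ Q, (1 + 2 * (κ / q) : ℝ))
        + t ^ R * (1 + κ / t) ^ Q.card := by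
  classical
  let P := Q.powerset.filter (fun S => S.card ≤ R)
  let C : Finset ℕ → ℝ := fun S =>
    (((Finset.range N).filter (fun m : ℕ => ∀ q ∈ S, (m : ZMod q) ∈ A q)).card : ℝ)
  -- the sifted set is counted by the truncated inclusion-exclusion sum
  have h1 : (((Finset.range N).filter (fun m : ℕ => ∀ q ∈ Q, (m : ZMod q) ∉ A q)).card : ℝ) ≤
      ∑ S ∈ P, (-1 : ℝ) ^ S.card * C S := by
    have e1 : (((Finset.range N).filter (fun m : ℕ => ∀ q ∈ Q, (m : ZMod q) ∉ A q)).card : ℝ)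
        = ∑ m ∈ Finset.range N,
          (if Q.filter (fun q => (m : ZMod q) ∈ A q) = ∅ then 1 else 0 : ℝ) := by
      rw [Finset.card_filter]
      push_cast
      refine Finset.sum_congr rfl fun m _ => ?_
      simp [Finset.filter_eq_empty_iff]
    have e2 : ∑ S ∈ P, (-1 : ℝ) ^ S.card * C S = ∑ m ∈ Finset.range N,
        ∑ S ∈ (Q.filter (fun q => (m : ZMod q) ∈ A q)).powerset with S.card ≤ R,
          (-1 : ℝ) ^ S.card := by
      have : ∀ S ∈ P, (-1 : ℝ) ^ S.card * C S = ∑ m ∈ Finset.range N,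
          if (∀ q ∈ S, (m : ZMod q) ∈ A q) then (-1 : ℝ) ^ S.card else 0 := by
        intro S _
        rw [← Finset.sum_filter, Finset.sum_const, nsmul_eq_mul, mul_comm]
      rw [Finset.sum_congr rfl this, Finset.sum_comm]
      refine Finset.sum_congr rfl fun m _ => ?_
      rw [← Finset.sum_filter]
      refine Finset.sum_congr ?_ fun _ _ => rfl
      ext S
      simp only [P, Finset.mem_filter, Finset.mem_powerset, Finset.subset_iff]
      constructor
      · rintro ⟨⟨a, b⟩, c⟩; exact ⟨fun q hq => ⟨a hq, c q hq⟩, b⟩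
      · rintro ⟨a, b⟩; exact ⟨⟨fun q hq => (a hq).1, b⟩, fun q hq => (a hq).2⟩
    rw [e1, e2]
    exact Finset.sum_le_sum fun m _ => bonferroni _ hR
  let w : Finset ℕ → ℝ := fun S => ∏ q ∈ S, (κ / q : ℝ)
  have hw : ∀ S, 0 ≤ w S := fun S => Finset.prod_nonneg fun q _ => by positivity
  have h2 : ∀ S ∈ P, (-1 : ℝ) ^ S.card * C S ≤
      N * ((-1 : ℝ) ^ S.card * w S) + (κ : ℝ) ^ S.card := by
    intro S hS
    have hSQ : S ⊆ Q := Finset.mem_powerset.1 (Finset.mem_filter.1 hS).1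
    have := abs_card_forall_natCast_mem_sub_le S (fun q hq => hQ q (hSQ hq)) A N
    rw [Finset.prod_congr rfl (fun q hq => by rw [hA q (hSQ hq)] :
      ∀ q ∈ S, ((A q).card / q : ℝ) = (κ / q : ℝ)),
      Finset.prod_congr rfl (fun q hq => by rw [hA q (hSQ hq)] :
      ∀ q ∈ S, ((A q).card : ℝ) = (κ : ℝ)), Finset.prod_const] at this
    have h3 : (-1 : ℝ) ^ S.card * (C S - N * w S) ≤ (κ : ℝ) ^ S.card := by
      refine (le_abs_self _).trans ?_
      rw [abs_mul, abs_pow, abs_neg, abs_one, one_pow, one_mul]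
      exact this
    linarith
  -- completing the main term costs the terms with more than `R` primes (Rankin's trick)
  have h3 : ∑ S ∈ P, (-1 : ℝ) ^ S.card * w S ≤
      ∏ q ∈ Q, (1 - κ / q : ℝ) + (1 / 2) ^ R * ∏ q ∈ Q, (1 + 2 * (κ / q) : ℝ) := by
    have e1 : ∏ q ∈ Q, (1 - κ / q : ℝ) = ∑ S ∈ Q.powerset, (-1 : ℝ) ^ S.card * w S := by
      simp only [sub_eq_add_neg, Finset.prod_one_add, w]
      refine Finset.sum_congr rfl fun S _ => ?_
      rw [Finset.prod_neg]
    have e2 : (1 / 2 : ℝ) ^ R * ∏ q ∈ Q, (1 + 2 * (κ / q) : ℝ)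
        = ∑ S ∈ Q.powerset, (1 / 2 : ℝ) ^ R * (2 ^ S.card * w S) := by
      simp only [Finset.prod_one_add, w, Finset.mul_sum]
      refine Finset.sum_congr rfl fun S _ => ?_
      rw [Finset.prod_mul_distrib, Finset.prod_const]
    rw [e1, e2, ← Finset.sum_add_distrib, Finset.sum_filter]
    refine Finset.sum_le_sum fun S _ => ?_
    have hp : 0 ≤ (1 / 2 : ℝ) ^ R * (2 ^ S.card * w S) := by have := hw S; positivity
    split_ifs with h
    · linarith
    · have h4 : (1 : ℝ) ≤ (1 / 2 : ℝ) ^ R * 2 ^ S.card := by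
        rw [one_div, inv_pow, inv_mul_eq_div, one_le_div (by positivity)]
        exact pow_le_pow_right₀ (by norm_num) (by omega)
      have h5 : w S ≤ (1 / 2 : ℝ) ^ R * (2 ^ S.card * w S) := by
        rw [← mul_assoc]; exact le_mul_of_one_le_left (hw S) h4
      have h6 : -w S ≤ (-1 : ℝ) ^ S.card * w S := by
        rcases neg_one_pow_eq_or ℝ S.card with h | h <;> rw [h] <;> linarith [hw S]
      linarith
  have h4 : ∑ S ∈ P, (κ : ℝ) ^ S.card ≤ t ^ R * (1 + κ / t) ^ Q.card := by
    have ht0 : 0 < t := by linarith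
    have e1 : (1 + κ / t) ^ Q.card = ∑ S ∈ Q.powerset, (κ / t) ^ S.card := by
      rw [← Finset.prod_const, Finset.prod_one_add]
      simp [div_pow]
    rw [e1, Finset.mul_sum, Finset.sum_filter]
    refine Finset.sum_le_sum fun S _ => ?_
    split_ifs with h
    · rw [div_pow, mul_div_left_comm]
      refine le_mul_of_one_le_right (by positivity) ?_
      rw [one_le_div (by positivity)]
      exact pow_le_pow_right₀ ht h
    · positivity
  calc _ ≤ _ := h1
    _ ≤ ∑ S ∈ P, (N * ((-1 : ℝ) ^ S.card * w S) + (κ : ℝ) ^ S.card) := Finset.sum_le_sum h2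
    _ = N * (∑ S ∈ P, (-1 : ℝ) ^ S.card * w S) + ∑ S ∈ P, (κ : ℝ) ^ S.card := by
        rw [Finset.sum_add_distrib, Finset.mul_sum]
    _ ≤ _ := by gcongr

/-! ### Mertens' lower bound and the choice of the sieving primes -/

/-- Expand the Euler product: every positive integer below `N` is `N`-smooth. -/
theorem log_le_prod_primesBelow {N : ℕ} (hN : 1 ≤ N) :
    Real.log N ≤ ∏ p ∈ N.primesBelow, (1 - 1 / p : ℝ)⁻¹ := by
  let f : ℕ →* ℝ :=
    { toFun := fun n => 1 / (n : ℝ)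
      map_one' := by simp
      map_mul' := by intro a b; push_cast; rw [one_div_mul_one_div] }
  have hf : ∀ {p : ℕ}, p.Prime → ‖f p‖ < 1 := by
    intro p hp
    have : (1 : ℝ) < p := by exact_mod_cast hp.one_lt
    simp only [f, MonoidHom.coe_mk, OneHom.coe_mk, norm_div, norm_one, RCLike.norm_natCast]
    exact (div_lt_one (by linarith)).2 this
  obtain ⟨h1, h2⟩ := EulerProduct.summable_and_hasSum_smoothNumbers_prod_primesBelow_geometric hf N
  have h3 : ∏ p ∈ N.primesBelow, (1 - f p)⁻¹ = ∏ p ∈ N.primesBelow, (1 - 1 / p : ℝ)⁻¹ := rfl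
  rw [← h3]
  have hmem : ∀ n ∈ Finset.Icc 1 (N - 1), n ∈ N.smoothNumbers := by
    intro n hn
    rw [Finset.mem_Icc] at hn
    exact Nat.mem_smoothNumbers_of_lt (by omega) (by omega)
  have h4 : ∑ n ∈ (Finset.Icc 1 (N - 1)).attach, f n ≤ ∏ p ∈ N.primesBelow, (1 - f p)⁻¹ := by
    have := sum_le_hasSum
      ((Finset.Icc 1 (N - 1)).attach.map
        ⟨fun n => (⟨n.1, hmem n.1 n.2⟩ : N.smoothNumbers), by
          intro a b h
          exact Subtype.ext (congrArg (fun t : N.smoothNumbers => (t : ℕ)) h)⟩)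
      (fun i _ => by simp [f]) h2
    rwa [Finset.sum_map] at this
  refine le_trans ?_ h4
  rw [Finset.sum_attach _ (fun n => f n)]
  have h5 := log_add_one_le_harmonic (N - 1)
  rw [harmonic_eq_sum_Icc] at h5
  push_cast [Nat.cast_sub hN] at h5
  simpa [f] using h5

/-- Bounded by the telescoping product over all integers from `2` to `H`. -/
theorem prod_inv_one_sub_le (H : ℕ) (hH : 1 ≤ H) (F : Finset ℕ)
    (hF : ∀ q ∈ F, q.Prime ∧ q ≤ H) : ∏ q ∈ F, (1 - 1 / q : ℝ)⁻¹ ≤ H := by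
  have h1 : ∀ n : ℕ, 1 ≤ n → ∏ q ∈ Finset.Icc 2 n, (1 - 1 / q : ℝ)⁻¹ = n := by
    intro n hn
    induction n, hn using Nat.le_induction with
    | base => simp
    | succ n hn ih =>
      rw [Finset.prod_Icc_succ_top (by omega), ih]
      have : (0 : ℝ) < n := by exact_mod_cast hn
      push_cast
      have h : (1 - 1 / ((n : ℝ) + 1)) = n / (n + 1) := by field_simp; ring
      rw [h]; field_simp
  rw [← h1 H hH]
  have h2 : ∀ q : ℕ, 2 ≤ q → 1 ≤ (1 - 1 / q : ℝ)⁻¹ := by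
    intro q hq
    have h2 : (1 : ℝ) < q := by exact_mod_cast hq
    have h3 : 1 / (q : ℝ) < 1 := (div_lt_one (by linarith)).2 h2
    have h4 : 0 < 1 / (q : ℝ) := by positivity
    exact (one_le_inv₀ (by linarith)).2 (by linarith)
  refine Finset.prod_le_prod_of_subset_of_one_le
    (fun q hq => Finset.mem_Icc.2 ⟨(hF q hq).1.two_le, (hF q hq).2⟩)
    (fun q hq => zero_le_one.trans (h2 q (hF q hq).1.two_le))
    (fun q hq _ => h2 q (Finset.mem_Icc.1 hq).1)

/-- A set of primes beyond `H` with both a lower and an upper bound for its Euler product. Stopping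
the product over all primes at its first value beyond `L` avoids any upper bound on sums over
primes; the primes up to `H` are left out at the cost of a factor `H`. -/
theorem exists_sieving_primes {H z : ℕ} (hH : 1 ≤ H) {L : ℝ} (hL : 1 ≤ L)
    (hz : L ≤ Real.log z) :
    ∃ Q : Finset ℕ, (∀ q ∈ Q, q.Prime ∧ H < q ∧ q < z) ∧
      ∏ q ∈ Q, (1 - 1 / q : ℝ) ≤ H / L ∧ ∏ q ∈ Q, (1 - 1 / q : ℝ)⁻¹ ≤ 2 * L := by
  have hpos : ∀ q : ℕ, q.Prime → (1 / 2 : ℝ) ≤ 1 - 1 / q := by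
    intro q hq
    have h2 : (2 : ℝ) ≤ q := by exact_mod_cast hq.two_le
    have : 1 / (q : ℝ) ≤ 1 / 2 := one_div_le_one_div_of_le (by norm_num) h2
    linarith
  have hz0 : 1 ≤ z := by
    rcases Nat.eq_zero_or_pos z with h | h
    · subst h; simp at hz; linarith
    · exact h
  have hex : ∃ n : ℕ, L ≤ ∏ p ∈ n.primesBelow, (1 - 1 / p : ℝ)⁻¹ :=
    ⟨z, hz.trans (log_le_prod_primesBelow hz0)⟩
  classical
  obtain ⟨n, hn, hmin⟩ : ∃ n : ℕ, L ≤ ∏ p ∈ n.primesBelow, (1 - 1 / p : ℝ)⁻¹ ∧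
      ∀ m < n, ∏ p ∈ m.primesBelow, (1 - 1 / p : ℝ)⁻¹ < L :=
    ⟨Nat.find hex, Nat.find_spec hex, fun m hm => not_le.1 (Nat.find_min hex hm)⟩
  have hnz : n ≤ z := by
    by_contra h
    exact absurd (hz.trans (log_le_prod_primesBelow hz0)) (not_le.2 (hmin z (by omega)))
  have hup : ∏ p ∈ n.primesBelow, (1 - 1 / p : ℝ)⁻¹ ≤ 2 * L := by
    rcases n with _ | m
    · simp; linarith
    · have h1 := hmin m (by omega)
      rw [Nat.primesBelow_succ]
      split_ifs with hp
      · rw [Finset.prod_insert (by simp [Nat.mem_primesBelow])]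
        have h2 : (1 - 1 / m : ℝ)⁻¹ ≤ 2 := by
          rw [inv_le_comm₀ (by linarith [hpos m hp]) (by norm_num)]
          linarith [hpos m hp]
        have h3 : 0 ≤ ∏ p ∈ m.primesBelow, (1 - 1 / p : ℝ)⁻¹ :=
          Finset.prod_nonneg fun p hp => inv_nonneg.2
            (by linarith [hpos p (Nat.prime_of_mem_primesBelow hp)])
        nlinarith
      · linarith
  have hsplit := Finset.prod_filter_mul_prod_filter_not n.primesBelow (fun q => H < q)
    (fun q : ℕ => (1 - 1 / q : ℝ)⁻¹)
  have hone : ∀ F ⊆ n.primesBelow, 1 ≤ ∏ q ∈ F, (1 - 1 / q : ℝ)⁻¹ := by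
    intro F hF
    refine Finset.one_le_prod fun q hq => ?_
    have := hpos q (Nat.prime_of_mem_primesBelow (hF hq))
    refine (one_le_inv₀ (by linarith)).2 ?_
    have : 0 ≤ 1 / (q : ℝ) := by positivity
    linarith
  have hsmall : ∏ q ∈ n.primesBelow.filter (fun q => ¬ H < q), (1 - 1 / q : ℝ)⁻¹ ≤ H :=
    prod_inv_one_sub_le H hH _ fun q hq =>
      ⟨Nat.prime_of_mem_primesBelow (Finset.mem_filter.1 hq).1,
        not_lt.1 (Finset.mem_filter.1 hq).2⟩
  have hone1 := hone _ (Finset.filter_subset (fun q => H < q) n.primesBelow)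
  have hone2 := hone _ (Finset.filter_subset (fun q => ¬ H < q) n.primesBelow)
  refine ⟨n.primesBelow.filter (fun q => H < q), ?_, ?_, ?_⟩
  · intro q hq
    rw [Finset.mem_filter, Nat.mem_primesBelow] at hq
    exact ⟨hq.1.2, hq.2, by omega⟩
  · rw [Finset.prod_inv_distrib] at hsplit hone1
    set V := ∏ q ∈ n.primesBelow.filter (fun q => H < q), (1 - 1 / q : ℝ)
    have hV : 0 < V := by
      by_contra h
      have : V⁻¹ ≤ 0 := inv_nonpos.2 (not_lt.1 h)
      linarith
    rw [le_div_iff₀ (by linarith)]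
    have h1 : L ≤ V⁻¹ * H := by
      rw [← hsplit] at hn
      exact hn.trans (mul_le_mul_of_nonneg_left hsmall (by linarith))
    rwa [inv_mul_eq_div, le_div_iff₀ hV, mul_comm] at h1
  · nlinarith

/-- The sieve bound with all parameters free. The sieving primes exceed `H`, so the elements of `E`
occupy `κ` different classes modulo each of them. -/
theorem primeTupleCount_le_sieve {κ H z R : ℕ} (hκ : 1 ≤ κ) (hκH : κ ≤ H) (hR : Even R) {L x : ℝ}
    (hL : 1 ≤ L) (hz : L ≤ Real.log z) (hx : 0 ≤ x) {E : Finset ℤ} (hE : E.card = κ)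
    (hEH : ∀ e ∈ E, 0 ≤ e ∧ e ≤ H) :
    (primeTupleCount x E : ℝ) ≤
      (x + 1) * ((H / L) ^ κ + (1 / 2) ^ R * (2 * L) ^ (2 * κ)) + 3 * (κ * z) ^ R + z := by
  classical
  obtain ⟨Q, hQ, hQ1, hQ2⟩ := exists_sieving_primes (hκ.trans hκH) hL hz
  have hz0 : 1 ≤ z := by
    rcases Nat.eq_zero_or_pos z with h | h
    · subst h; simp at hz; linarith
    · exact h
  let A : (q : ℕ) → Finset (ZMod q) := fun q => E.image (fun e : ℤ => -(e : ZMod q))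
  have hA : ∀ q ∈ Q, (A q).card = κ := by
    intro q hq
    rw [← hE]
    refine Finset.card_image_of_injOn ?_
    intro a ha b hb hab
    have h1 := hEH a ha
    have h2 := hEH b hb
    have h3 := (hQ q hq).2.1
    have h4 : (q : ℤ) ∣ b - a := (ZMod.intCast_eq_intCast_iff_dvd_sub a b q).1 (neg_injective hab)
    have h5 : |b - a| < q := by rw [abs_lt]; constructor <;> omega
    have := Int.eq_zero_of_abs_lt_dvd h4 h5
    omega
  have hsub : {m : ℕ | 0 < m ∧ (m : ℝ) ≤ x ∧ ∀ d ∈ E, Nat.Prime ((m : ℤ) + d).toNat} ⊆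
      (((Finset.range (⌊x⌋₊ + 1)).filter (fun m : ℕ => ∀ q ∈ Q, (m : ZMod q) ∉ A q) ∪
        Finset.range z : Finset ℕ) : Set ℕ) := by
    rintro m ⟨_, hm, hp⟩
    simp only [Finset.coe_union, Set.mem_union, Finset.mem_coe, Finset.mem_filter,
      Finset.mem_range]
    by_cases h : ∀ q ∈ Q, (m : ZMod q) ∉ A q
    · exact Or.inl ⟨Nat.lt_succ_of_le (Nat.le_floor hm), h⟩
    · right
      push Not at h
      obtain ⟨q, hq, hmq⟩ := h
      obtain ⟨e, he, hem⟩ := Finset.mem_image.1 hmq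
      have h1 := hEH e he
      have h2 : ((((m : ℤ) + e).toNat : ℕ) : ℤ) = m + e := Int.toNat_of_nonneg (by omega)
      have h3 : q ∣ ((m : ℤ) + e).toNat := by
        rw [← Int.natCast_dvd_natCast, h2, ← ZMod.intCast_zmod_eq_zero_iff_dvd]
        push_cast
        rw [← hem]; ring
      have h4 := ((Nat.prime_dvd_prime_iff_eq (hQ q hq).1 (hp e he)).1 h3)
      have h5 := (hQ q hq).2.2
      omega
  have hcard : (primeTupleCount x E : ℝ) ≤
      ((Finset.range (⌊x⌋₊ + 1)).filter (fun m : ℕ => ∀ q ∈ Q, (m : ZMod q) ∉ A q)).card + z := by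
    have h1 := Set.ncard_le_ncard hsub (Finset.finite_toSet _)
    rw [Set.ncard_coe_finset] at h1
    have h2 := h1.trans (Finset.card_union_le _ _)
    rw [Finset.card_range] at h2
    exact_mod_cast h2
  have hκz : (1 : ℝ) ≤ κ * z := by exact_mod_cast Nat.mul_pos hκ hz0
  have hbrun := card_sifted_le Q (fun q hq => (hQ q hq).1) A hA (⌊x⌋₊ + 1) hR hκz
  have hq0 : ∀ q ∈ Q, 0 < (1 / q : ℝ) ∧ (κ / q : ℝ) ≤ 1 ∧ (1 / q : ℝ) < 1 := by
    intro q hq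
    have h1 : (0 : ℝ) < q := by exact_mod_cast (hQ q hq).1.pos
    have h2 : (1 : ℝ) < q := by exact_mod_cast (hQ q hq).1.one_lt
    have h3 : (κ : ℝ) ≤ q := by exact_mod_cast hκH.trans (hQ q hq).2.1.le
    exact ⟨by positivity, (div_le_one h1).2 h3, (div_lt_one h1).2 h2⟩
  have hm1 : ∏ q ∈ Q, (1 - κ / q : ℝ) ≤ (H / L) ^ κ := by
    refine le_trans ?_ (pow_le_pow_left₀ (Finset.prod_nonneg fun q hq => by
      linarith [(hq0 q hq).2.2]) hQ1 κ)
    rw [← Finset.prod_pow]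
    refine Finset.prod_le_prod (fun q hq => by linarith [(hq0 q hq).2.1]) fun q hq => ?_
    have := one_add_mul_le_pow (a := -(1 / q : ℝ)) (by linarith [(hq0 q hq).2.2]) κ
    calc (1 - κ / q : ℝ) = 1 + κ * -(1 / q : ℝ) := by ring
      _ ≤ _ := this
      _ = _ := by ring
  have hm2 : ∏ q ∈ Q, (1 + 2 * (κ / q) : ℝ) ≤ (2 * L) ^ (2 * κ) := by
    refine le_trans ?_ (pow_le_pow_left₀ (Finset.prod_nonneg fun q hq => inv_nonneg.2 (by
      linarith [(hq0 q hq).2.2])) hQ2 (2 * κ))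
    rw [← Finset.prod_pow]
    refine Finset.prod_le_prod (fun q hq => by positivity) fun q hq => ?_
    have h1 := one_add_mul_le_pow (a := (1 / q : ℝ)) (by linarith [(hq0 q hq).1]) (2 * κ)
    have h2 : 1 + (1 / q : ℝ) ≤ (1 - 1 / q : ℝ)⁻¹ := by
      rw [← one_div (1 - 1 / q : ℝ), le_div_iff₀ (by linarith [(hq0 q hq).2.2])]
      nlinarith [(hq0 q hq).1]
    calc (1 + 2 * (κ / q) : ℝ) = 1 + ((2 * κ : ℕ) : ℝ) * (1 / q : ℝ) := by push_cast; ring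
      _ ≤ _ := h1
      _ ≤ _ := pow_le_pow_left₀ (by linarith [(hq0 q hq).1]) h2 _
  have hz1 : (0 : ℝ) < z := by exact_mod_cast hz0
  have hκ0 : (0 : ℝ) < κ := by exact_mod_cast hκ
  have hm3 : (1 + κ / (κ * z) : ℝ) ^ Q.card ≤ 3 := by
    have e1 : (1 + κ / (κ * z) : ℝ) = 1 + 1 / z := by field_simp
    have e2 : Q.card ≤ z := by
      have : Q ⊆ Finset.range z := fun q hq => Finset.mem_range.2 (hQ q hq).2.2
      simpa using Finset.card_le_card this
    rw [e1]
    calc (1 + 1 / z : ℝ) ^ Q.card ≤ (1 + 1 / z : ℝ) ^ z :=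
          pow_le_pow_right₀ (by linarith [show 0 ≤ (1 / z : ℝ) by positivity]) e2
      _ ≤ (Real.exp (1 / z)) ^ z := by
          refine pow_le_pow_left₀ (by positivity) ?_ _
          linarith [Real.add_one_le_exp (1 / z : ℝ)]
      _ = Real.exp 1 := by rw [← Real.exp_nat_mul]; congr 1; field_simp
      _ ≤ 3 := by linarith [Real.exp_one_lt_d9]
  have hN : ((⌊x⌋₊ + 1 : ℕ) : ℝ) ≤ x + 1 := by
    push_cast; linarith [Nat.floor_le hx]
  have hHL : 0 ≤ (H / L : ℝ) := div_nonneg (by positivity) (by linarith)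
  refine hcard.trans ?_
  refine add_le_add_left (hbrun.trans ?_) _
  refine add_le_add ?_ ?_
  · refine (mul_le_mul_of_nonneg_left (add_le_add hm1 (mul_le_mul_of_nonneg_left hm2
      (by positivity))) (by positivity)).trans ?_
    exact mul_le_mul_of_nonneg_right hN (by positivity)
  · rw [mul_comm (3 : ℝ)]
    exact mul_le_mul_of_nonneg_left hm3 (by positivity)

/-! ### The sieve bound for prime tuples -/

theorem eventually_const_mul_log_add_le_rpow (a b : ℝ) {c : ℝ} (hc : 0 < c) :
    ∀ᶠ t : ℝ in atTop, a * Real.log t + b ≤ t ^ c := by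
  have h1 : (fun t : ℝ => a * Real.log t + b) =o[atTop] fun t : ℝ => t ^ c := by
    refine ((isLittleO_log_rpow_atTop hc).const_mul_left a).add ?_
    exact Asymptotics.isLittleO_const_left.2 (Or.inr
      (tendsto_norm_atTop_atTop.comp (tendsto_rpow_atTop hc)))
  filter_upwards [h1.bound one_pos, eventually_ge_atTop 0] with t ht ht0
  rw [one_mul, Real.norm_of_nonneg (Real.rpow_nonneg ht0 c)] at ht
  exact (le_abs_self _).trans ht

set_option maxHeartbeats 500000 in
/-- For sets of `n + 1` integers in `[0, log ^ c x]`, where `c = 1 / (4 (n + 1))`, the number of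
prime tuples up to `x` is `o(x / log ^ (n + c) x)`. The sieve has the primes up to `x ^ (1 / (4 R))`
at its disposal, with `R` of the order of `log log x`, and saves `log ^ ((1 - 2 c) (n + 1)) x`. -/
theorem eventually_primeTupleCount_mul_le (n : ℕ) {δ : ℝ} (hδ : 0 < δ) :
    ∀ᶠ x : ℝ in atTop, ∀ E : Finset ℤ, E.card = n + 1 →
      (∀ e ∈ E, 0 ≤ e ∧ (e : ℝ) ≤ Real.log x ^ (1 / (4 * ((n : ℝ) + 1)))) →
      (primeTupleCount x E : ℝ) *
        (Real.log x ^ n * Real.log x ^ (1 / (4 * ((n : ℝ) + 1)))) ≤ δ * x := by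
  set K : ℝ := (n : ℝ) + 1 with hK
  set c : ℝ := 1 / (4 * K) with hc
  have hK1 : 1 ≤ K := by rw [hK]; linarith [Nat.cast_nonneg (α := ℝ) n]
  have hc0 : 0 < c := by positivity
  have hcK : c * K = 1 / 4 := by rw [hc]; field_simp
  have hc4 : c ≤ 1 / 4 := by nlinarith
  have ev1 : ∀ᶠ t : ℝ in atTop, Real.exp 1 ≤ t := eventually_ge_atTop _
  have ev2 : ∀ᶠ t : ℝ in atTop, K ≤ t ^ c := (tendsto_rpow_atTop hc0).eventually_ge_atTop _
  have ev3 : ∀ᶠ t : ℝ in atTop, 48 * K * Real.log t + 16 ≤ t ^ c :=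
    eventually_const_mul_log_add_le_rpow _ _ hc0
  have ev4 : ∀ᶠ t : ℝ in atTop, max 1 (Real.log K) ≤ t ^ (1 - c) :=
    (tendsto_rpow_atTop (by linarith)).eventually_ge_atTop _
  have ev5 : ∀ᶠ t : ℝ in atTop, 2 * (1 + 4 ^ (n + 1)) * t ^ (-(1 / 2 - c)) ≤ δ / 2 := by
    have := (tendsto_rpow_neg_atTop (y := 1 / 2 - c) (by linarith)).const_mul
      (2 * (1 + 4 ^ (n + 1)) : ℝ)
    rw [mul_zero] at this
    exact this.eventually_le_const (by linarith)
  have ev6 : ∀ᶠ t : ℝ in atTop, 4 * (t ^ ((n : ℝ) + c) * Real.exp (-(1 / 2) * t)) ≤ δ / 2 := by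
    have := (tendsto_rpow_mul_exp_neg_mul_atTop_nhds_zero ((n : ℝ) + c) (1 / 2)
      (by norm_num)).const_mul (4 : ℝ)
    rw [mul_zero] at this
    exact this.eventually_le_const (by linarith)
  filter_upwards [Real.tendsto_log_atTop.eventually (ev1.and (ev2.and (ev3.and
    (ev4.and (ev5.and ev6))))), eventually_ge_atTop 1] with x hx hx1 E hE hEH
  set t := Real.log x with ht
  obtain ⟨h1, h2, h3, h4, h5, h6⟩ := hx
  have hxt : x = Real.exp t := (Real.exp_log (by linarith)).symm
  have ht1 : 1 < t := (Real.one_lt_exp_iff.2 one_pos).trans_le h1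
  have ht0 : 0 < t := by linarith
  have hlt : 1 ≤ Real.log t := by rwa [Real.le_log_iff_exp_le ht0]
  -- the number of steps of the inclusion-exclusion
  set R : ℕ := 2 * ⌈3 * K * Real.log t⌉₊ with hRdef
  have hRev : Even R := even_two_mul _
  have hR1 : 6 * K * Real.log t ≤ R := by
    rw [hRdef]; push_cast
    linarith [Nat.le_ceil (3 * K * Real.log t)]
  have hR2 : (R : ℝ) ≤ 6 * K * Real.log t + 2 := by
    rw [hRdef]; push_cast
    linarith [Nat.ceil_lt_add_one (show 0 ≤ 3 * K * Real.log t by positivity)]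
  have hR0 : (0 : ℝ) < R := lt_of_lt_of_le (by positivity) hR1
  clear_value R
  set L : ℝ := t ^ (1 - c) with hLdef
  have hL1 : 1 ≤ L := (le_max_left _ _).trans h4
  -- sieving up to `z = x ^ (1 / (4 R))` keeps the error term `z ^ (2 R)` below `x ^ (1 / 2)`
  set z : ℕ := ⌊Real.exp (t / (4 * R))⌋₊ with hzdef
  have hzle : (z : ℝ) ≤ Real.exp (t / (4 * R)) := Nat.floor_le (Real.exp_pos _).le
  have hu : L + 1 ≤ t / (4 * R) := by
    rw [le_div_iff₀ (by positivity)]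
    have e1 : t ^ c * L = t := by rw [hLdef, ← Real.rpow_add ht0]; simp
    nlinarith
  have hzlog : L ≤ Real.log z := by
    have e1 : Real.exp L ≤ z := by
      have e2 := Nat.lt_floor_add_one (Real.exp (t / (4 * R)))
      have e3 : Real.exp (L + 1) ≤ Real.exp (t / (4 * R)) := Real.exp_le_exp.2 hu
      rw [Real.exp_add] at e3
      have e4 : 1 ≤ Real.exp L := Real.one_le_exp (by linarith)
      have e5 : 2 ≤ Real.exp 1 := by linarith [Real.add_one_le_exp 1]
      nlinarith
    exact (Real.le_log_iff_exp_le ((Real.exp_pos _).trans_le e1)).2 e1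
  clear_value z
  have hz0 : (0 : ℝ) < z := by
    rcases Nat.eq_zero_or_pos z with h | h
    · rw [h] at hzlog; simp at hzlog; linarith
    · exact_mod_cast h
  have hKz : K ≤ z := by
    rw [← Real.log_le_log_iff (by linarith) hz0]
    exact ((le_max_right _ _).trans h4).trans hzlog
  set H : ℕ := ⌊t ^ c⌋₊ with hHdef
  have hHle : (H : ℝ) ≤ t ^ c := Nat.floor_le (by positivity)
  have hκH : n + 1 ≤ H := Nat.le_floor (by push_cast; exact h2)
  have hEH' : ∀ e ∈ E, 0 ≤ e ∧ e ≤ H := by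
    intro e he
    obtain ⟨a, b⟩ := hEH e he
    lift e to ℕ using a
    exact ⟨by omega, by exact_mod_cast Nat.le_floor (by exact_mod_cast b)⟩
  clear_value H
  have hmain := primeTupleCount_le_sieve (κ := n + 1) (by omega) hκH hRev hL1 hzlog
    (by linarith : 0 ≤ x) hE hEH'
  set u : ℝ := t ^ (2 * c - 1) with hudef
  have hu0 : 0 < u := Real.rpow_pos_of_pos ht0 _
  have b1 : (H / L : ℝ) ^ (n + 1) ≤ u ^ (n + 1) := by
    refine pow_le_pow_left₀ (by positivity) ?_ _
    rw [div_le_iff₀ (by linarith), hudef, hLdef, ← Real.rpow_add ht0]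
    rwa [show 2 * c - 1 + (1 - c) = c by ring]
  have b2 : (1 / 2 : ℝ) ^ R * (2 * L) ^ (2 * (n + 1)) ≤ 4 ^ (n + 1) * u ^ (n + 1) := by
    have e1 : (1 / 2 : ℝ) ^ R ≤ (t⁻¹) ^ (3 * (n + 1)) := by
      have f1 : (1 / 2 : ℝ) ≤ Real.exp (-(1 / 2)) := by
        linarith [Real.add_one_le_exp (-(1 / 2) : ℝ)]
      calc (1 / 2 : ℝ) ^ R ≤ Real.exp (-(1 / 2)) ^ R := pow_le_pow_left₀ (by norm_num) f1 _
        _ = Real.exp (R * (-(1 / 2))) := (Real.exp_nat_mul _ _).symm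
        _ ≤ Real.exp (((3 * (n + 1) : ℕ) : ℝ) * (-Real.log t)) := by
            apply Real.exp_le_exp.2; push_cast; rw [← hK]; linarith
        _ = (t⁻¹) ^ (3 * (n + 1)) := by
            rw [Real.exp_nat_mul, Real.exp_neg, Real.exp_log ht0]
    have e2 : L ≤ t := by
      calc L ≤ t ^ (1 : ℝ) := Real.rpow_le_rpow_of_exponent_le ht1.le (by linarith)
        _ = t := Real.rpow_one t
    have e3 : t⁻¹ ≤ u := by
      rw [← Real.rpow_neg_one]
      exact Real.rpow_le_rpow_of_exponent_le ht1.le (by linarith)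
    calc (1 / 2 : ℝ) ^ R * (2 * L) ^ (2 * (n + 1))
        ≤ (t⁻¹) ^ (3 * (n + 1)) * (2 * t) ^ (2 * (n + 1)) := by gcongr
      _ = 4 ^ (n + 1) * (t⁻¹) ^ (n + 1) := by
          rw [pow_mul, pow_mul (2 * t), ← mul_pow, ← mul_pow]
          congr 1; field_simp; norm_num
      _ ≤ 4 ^ (n + 1) * u ^ (n + 1) := by gcongr
  have hzexp : ∀ j : ℕ, (z : ℝ) ^ (j * R) ≤ Real.exp (j * t / 4) := by
    intro j
    calc (z : ℝ) ^ (j * R) ≤ Real.exp (t / (4 * R)) ^ (j * R) := pow_le_pow_left₀ hz0.le hzle _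
      _ = Real.exp (j * t / 4) := by
          rw [← Real.exp_nat_mul]; congr 1; push_cast; field_simp
  have b3 : (((n + 1 : ℕ) : ℝ) * z) ^ R ≤ Real.exp (t / 2) := by
    calc (((n + 1 : ℕ) : ℝ) * z) ^ R ≤ (z * z : ℝ) ^ R := by
          push_cast; rw [← hK]; gcongr
      _ = (z : ℝ) ^ (2 * R) := by rw [← sq, ← pow_mul]
      _ ≤ _ := hzexp 2
      _ = _ := by congr 1; push_cast; ring
  have b4 : (z : ℝ) ≤ Real.exp (t / 2) := by
    refine hzle.trans (Real.exp_le_exp.2 ?_)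
    have : (1 : ℝ) ≤ R := by
      have : 1 ≤ 6 * K * Real.log t := by nlinarith
      linarith
    exact div_le_div_of_nonneg_left ht0.le (by norm_num) (by linarith)
  have b5 : (primeTupleCount x E : ℝ) ≤
      2 * x * (1 + 4 ^ (n + 1)) * u ^ (n + 1) + 4 * Real.exp (t / 2) := by
    have e1 : (x + 1) * ((H / L : ℝ) ^ (n + 1) + (1 / 2) ^ R * (2 * L) ^ (2 * (n + 1))) ≤
        (2 * x) * (u ^ (n + 1) + 4 ^ (n + 1) * u ^ (n + 1)) := by
      apply mul_le_mul (by linarith) (add_le_add b1 b2) (by positivity) (by linarith)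
    linarith
  have b6 : u ^ (n + 1) * (t ^ n * t ^ c) = t ^ (-(1 / 2 - c)) := by
    rw [hudef, ← Real.rpow_natCast, ← Real.rpow_natCast, ← Real.rpow_mul ht0.le,
      ← Real.rpow_add ht0, ← Real.rpow_add ht0]
    congr 1
    push_cast
    have : c * n = 1 / 4 - c := by rw [hK] at hcK; linarith
    linarith
  have b7 : t ^ n * t ^ c = t ^ ((n : ℝ) + c) := by
    rw [Real.rpow_add ht0, Real.rpow_natCast]
  have b8 : Real.exp (t / 2) = x * Real.exp (-(1 / 2) * t) := by
    rw [hxt, ← Real.exp_add]; congr 1; ring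
  calc (primeTupleCount x E : ℝ) * (t ^ n * t ^ c)
      ≤ (2 * x * (1 + 4 ^ (n + 1)) * u ^ (n + 1) + 4 * Real.exp (t / 2)) * (t ^ n * t ^ c) := by
        gcongr
    _ = x * (2 * (1 + 4 ^ (n + 1)) * (u ^ (n + 1) * (t ^ n * t ^ c)))
        + x * (4 * (t ^ n * t ^ c * Real.exp (-(1 / 2) * t))) := by rw [b8]; ring
    _ ≤ x * (δ / 2) + x * (δ / 2) := by
        rw [b6, b7]
        gcongr
    _ = δ * x := by ring

/-! ### Consecutive primes and prime tuples -/

theorem finite_tupleSet (x : ℝ) (D : Finset ℤ) :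
    {m : ℕ | 0 < m ∧ (m : ℝ) ≤ x ∧ ∀ d ∈ D, Nat.Prime ((m : ℤ) + d).toNat}.Finite :=
  (Set.finite_Iic ⌊x⌋₊).subset fun _ hm => Nat.le_floor hm.2.1

theorem finite_gapSet (k : ℕ) (x : ℝ) (D : Finset ℤ) :
    {n : ℕ | (Nat.nth Nat.Prime (n + k) : ℝ) ≤ x ∧
      (Finset.Icc 1 k).image
        (fun i => (Nat.nth Nat.Prime (n + i) : ℤ) - (Nat.nth Nat.Prime n : ℤ)) = D}.Finite := by
  refine (Set.finite_Iic ⌊x⌋₊).subset fun n hn => ?_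
  have h1 : n + k + 2 ≤ Nat.nth Nat.Prime (n + k) := Nat.add_two_le_nth_prime _
  have h2 : Nat.nth Nat.Prime (n + k) ≤ ⌊x⌋₊ := Nat.le_floor hn.1
  exact Set.mem_Iic.2 (by omega)

theorem nth_prime_strictMono : StrictMono (Nat.nth Nat.Prime) :=
  Nat.nth_strictMono Nat.infinite_setOfPred_prime

theorem nth_prime_succ_le {j ℓ : ℕ} (hℓ : ℓ.Prime) (h : Nat.nth Nat.Prime j < ℓ) :
    Nat.nth Nat.Prime (j + 1) ≤ ℓ := by
  have h1 := Nat.nth_count hℓ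
  rw [← h1] at h ⊢
  exact nth_prime_strictMono.monotone (nth_prime_strictMono.lt_iff_lt.1 h)

theorem pos_of_mem_of_gapCount_pos {k : ℕ} {x : ℝ} {D : Finset ℤ} (h : 0 < gapCount k x D) :
    ∀ d ∈ D, 0 < d ∧ (d : ℝ) ≤ x := by
  obtain ⟨n, hn, hD⟩ := (Set.ncard_pos (finite_gapSet k x D)).1 h
  intro d hd
  rw [← hD] at hd
  obtain ⟨i, hi, rfl⟩ := Finset.mem_image.1 hd
  rw [Finset.mem_Icc] at hi
  have h1 : Nat.nth Nat.Prime n < Nat.nth Nat.Prime (n + i) := nth_prime_strictMono (by omega)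
  have h2 : Nat.nth Nat.Prime (n + i) ≤ Nat.nth Nat.Prime (n + k) :=
    nth_prime_strictMono.monotone (by omega)
  refine ⟨by omega, ?_⟩
  have h3 : (Nat.nth Nat.Prime (n + i) : ℝ) ≤ Nat.nth Nat.Prime (n + k) := by exact_mod_cast h2
  push_cast
  have h4 : (0 : ℝ) ≤ Nat.nth Nat.Prime n := by positivity
  linarith

theorem gapCount_le_primeTupleCount (k : ℕ) (x : ℝ) (D : Finset ℤ) :
    gapCount k x D ≤ primeTupleCount x (insert 0 D) := by
  refine Set.ncard_le_ncard_of_injOn (Nat.nth Nat.Prime) ?_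
    nth_prime_strictMono.injective.injOn (finite_tupleSet _ _)
  rintro n ⟨hn, hD⟩
  have h1 : Nat.nth Nat.Prime n ≤ Nat.nth Nat.Prime (n + k) :=
    nth_prime_strictMono.monotone (by omega)
  refine ⟨(Nat.prime_nth_prime n).pos, le_trans (by exact_mod_cast h1) hn, ?_⟩
  intro d hd
  rw [Finset.mem_insert] at hd
  rcases hd with rfl | hd
  · simp
  · rw [← hD] at hd
    obtain ⟨i, -, rfl⟩ := Finset.mem_image.1 hd
    simp

/-- The differences `p_{n+k} - p_n` with `p_{n+k} ≤ x` add up to at most `k x`, so that a tuple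
with a large element can occur only rarely. -/
theorem gapCount_mul_le {k : ℕ} {x : ℝ} (hx : 0 ≤ x) {D : Finset ℤ} {h : ℤ} (hh : h ∈ D) :
    (gapCount k x D : ℝ) * h ≤ k * x := by
  set a : ℕ → ℝ := fun n => (Nat.nth Nat.Prime n : ℝ) with ha
  have ha0 : ∀ n, 0 ≤ a n := fun n => Nat.cast_nonneg _
  have hmono : Monotone a := fun m n hmn =>
    Nat.cast_le.2 (nth_prime_strictMono.monotone hmn)
  have hfin := finite_gapSet k x D
  have hcard : gapCount k x D = hfin.toFinset.card := Set.ncard_eq_toFinset_card _ hfin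
  set G := hfin.toFinset with hG
  have hmem : ∀ n ∈ G, a (n + k) ≤ x ∧ (h : ℝ) ≤ a (n + k) - a n := by
    intro n hn
    obtain ⟨h1, h2⟩ := hfin.mem_toFinset.1 hn
    refine ⟨h1, ?_⟩
    rw [← h2] at hh
    obtain ⟨i, hi, rfl⟩ := Finset.mem_image.1 hh
    have := hmono (show n + i ≤ n + k by have := (Finset.mem_Icc.1 hi).2; omega)
    push_cast
    exact sub_le_sub_right this _
  rw [hcard]
  rcases G.eq_empty_or_nonempty with h0 | h0
  · rw [h0]; simp; positivity
  · set M := G.max' h0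
    have hsub : G ⊆ Finset.range (M + 1) := fun n hn =>
      Finset.mem_range.2 (Nat.lt_succ_of_le (G.le_max' n hn))
    have hM : a (M + k) ≤ x := (hmem M (G.max'_mem h0)).1
    have htel : ∑ n ∈ Finset.range (M + 1), (a (n + k) - a n) =
        ∑ i ∈ Finset.range k, a (M + 1 + i) - ∑ i ∈ Finset.range k, a i := by
      have e1 := Finset.sum_range_add a (M + 1) k
      have e2 := Finset.sum_range_add a k (M + 1)
      rw [add_comm k (M + 1), e1] at e2
      simp only [add_comm k] at e2
      rw [Finset.sum_sub_distrib]
      linarith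
    calc (G.card : ℝ) * h = ∑ n ∈ G, (h : ℝ) := by rw [Finset.sum_const, nsmul_eq_mul]
      _ ≤ ∑ n ∈ G, (a (n + k) - a n) := Finset.sum_le_sum fun n hn => (hmem n hn).2
      _ ≤ ∑ n ∈ Finset.range (M + 1), (a (n + k) - a n) :=
          Finset.sum_le_sum_of_subset_of_nonneg hsub fun n _ _ =>
            sub_nonneg.2 (hmono (by omega))
      _ ≤ ∑ i ∈ Finset.range k, a (M + 1 + i) := by
          rw [htel]
          have : 0 ≤ ∑ i ∈ Finset.range k, a i := Finset.sum_nonneg fun i _ => ha0 i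
          linarith
      _ ≤ ∑ i ∈ Finset.range k, x := Finset.sum_le_sum fun i hi =>
          (hmono (by have := Finset.mem_range.1 hi; omega)).trans hM
      _ = k * x := by simp

/-- The set `{P, 2P, …, kP}`. -/
def multiples (k P : ℕ) : Finset ℤ := (Finset.Icc 1 k).image fun i : ℕ => (P : ℤ) * i

theorem card_multiples (k : ℕ) {P : ℕ} (hP : 0 < P) : (multiples k P).card = k := by
  rw [multiples, Finset.card_image_of_injective]
  · simp
  · intro a b hab
    have : (P : ℤ) ≠ 0 := by exact_mod_cast hP.ne'
    exact_mod_cast mul_left_cancel₀ this hab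

theorem le_of_mem_multiples {k P : ℕ} {d : ℤ} (hd : d ∈ multiples k P) :
    (P : ℤ) ≤ d ∧ d ≤ k * P := by
  obtain ⟨i, hi, rfl⟩ := Finset.mem_image.1 hd
  rw [Finset.mem_Icc] at hi
  have h1 : (1 : ℤ) ≤ i := by exact_mod_cast hi.1
  have h2 : (i : ℤ) ≤ k := by exact_mod_cast hi.2
  have h3 : (0 : ℤ) ≤ P := by positivity
  constructor <;> nlinarith

/-- If `m, m + P, …, m + k P` are primes and there are no other primes between them, then they are
consecutive in the enumeration of the primes. -/
theorem nth_prime_add_eq {k P m : ℕ} (hP : 0 < P) (hm : m.Prime)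
    (hp : ∀ i ∈ Finset.Icc 1 k, (m + P * i).Prime)
    (hno : ∀ e : ℕ, 1 ≤ e → e ≤ k * P → (e : ℤ) ∉ multiples k P → ¬ (m + e).Prime) :
    ∀ i ≤ k, Nat.nth Nat.Prime (Nat.count Nat.Prime m + i) = m + P * i := by
  intro i
  induction i with
  | zero => intro _; simpa using Nat.nth_count hm
  | succ i ih =>
    intro hi
    have h0 := ih (by omega)
    have h1 := hp (i + 1) (Finset.mem_Icc.2 ⟨by omega, hi⟩)
    have h2 : Nat.nth Nat.Prime (Nat.count Nat.Prime m + i + 1) ≤ m + P * (i + 1) := by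
      refine nth_prime_succ_le h1 ?_
      rw [h0]
      have := Nat.mul_lt_mul_of_pos_left (Nat.lt_succ_self i) hP
      rw [Nat.succ_eq_add_one] at this
      omega
    have h3 : m + P * i < Nat.nth Nat.Prime (Nat.count Nat.Prime m + i + 1) := by
      rw [← h0]; exact nth_prime_strictMono (Nat.lt_succ_self _)
    rw [← add_assoc]
    refine le_antisymm h2 (not_lt.1 fun h4 => ?_)
    have h5 := Nat.prime_nth_prime (Nat.count Nat.Prime m + i + 1)
    obtain ⟨e, he⟩ : ∃ e, Nat.nth Nat.Prime (Nat.count Nat.Prime m + i + 1) = m + e :=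
      ⟨_, (Nat.add_sub_cancel' (by omega)).symm⟩
    rw [he] at h5 h3 h4
    have h6 : P * i < e := by omega
    have h7 : e < P * (i + 1) := by omega
    refine hno e (by omega) ?_ ?_ h5
    · have : P * (i + 1) ≤ P * k := Nat.mul_le_mul_left P hi
      rw [mul_comm k]; omega
    · intro hmem
      obtain ⟨j, -, hj⟩ := Finset.mem_image.1 hmem
      have hj' : P * j = e := by exact_mod_cast hj
      rw [← hj'] at h6 h7
      have := Nat.lt_of_mul_lt_mul_left h6
      have := Nat.lt_of_mul_lt_mul_left h7
      omega

/-- A prime tuple of shape `{0, P, …, kP}` consists of consecutive primes, or reaches beyond `x`, or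
can be extended by a further prime lying between its elements. -/
theorem primeTupleCount_le_gapCount_add (k : ℕ) {P : ℕ} (hP : 0 < P) (x : ℝ) :
    primeTupleCount x (insert 0 (multiples k P)) ≤ gapCount k x (multiples k P) + k * P +
      ∑ e ∈ Finset.Icc (1 : ℤ) (k * P) \ multiples k P,
        primeTupleCount x (insert e (insert 0 (multiples k P))) := by
  classical
  set D := multiples k P with hD
  set T : Finset ℤ → Set ℕ := fun D =>
    {m : ℕ | 0 < m ∧ (m : ℝ) ≤ x ∧ ∀ d ∈ D, Nat.Prime ((m : ℤ) + d).toNat} with hT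
  have hfin := finite_gapSet k x D
  have hTf : ∀ D, (T D).Finite := finite_tupleSet x
  set X := Finset.Icc (1 : ℤ) (k * P) \ D with hX
  have hsub : T (insert 0 D) ⊆
      ((hfin.toFinset.image (Nat.nth Nat.Prime) ∪ Finset.Ioc (⌊x⌋₊ - k * P) ⌊x⌋₊) ∪
        X.biUnion (fun e => (hTf (insert e (insert 0 D))).toFinset) : Finset ℕ) := by
    rintro m ⟨hm0, hmx, hmp⟩
    by_contra hcon
    simp only [Finset.coe_union, Set.mem_union, Finset.mem_coe, not_or, Finset.mem_Ioc,
      Finset.mem_biUnion, Set.Finite.mem_toFinset, not_exists, not_and, Finset.mem_image] at hcon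
    obtain ⟨⟨hc1, hc2⟩, hc3⟩ := hcon
    have hmfl : m ≤ ⌊x⌋₊ := Nat.le_floor hmx
    have hmP : m + k * P ≤ ⌊x⌋₊ := by
      by_contra h
      exact hc2 (by omega) hmfl
    have hmprime : m.Prime := by simpa using hmp 0 (Finset.mem_insert_self _ _)
    have key := nth_prime_add_eq hP hmprime (k := k) (fun i hi => by
      have h1 := hmp ((P : ℤ) * i)
        (Finset.mem_insert_of_mem (Finset.mem_image.2 ⟨i, hi, rfl⟩))
      have h2 : ((m : ℤ) + P * i).toNat = m + P * i := by
        rw [show ((m : ℤ) + P * i) = ((m + P * i : ℕ) : ℤ) by push_cast; ring]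
        exact Int.toNat_natCast _
      rwa [h2] at h1) (fun e he1 he2 he3 hep => by
      refine hc3 e ?_ ⟨hm0, hmx, ?_⟩
      · exact Finset.mem_sdiff.2 ⟨Finset.mem_Icc.2 ⟨by exact_mod_cast he1, by exact_mod_cast he2⟩,
          he3⟩
      · intro d hd
        rcases Finset.mem_insert.1 hd with rfl | hd
        · rw [← Nat.cast_add, Int.toNat_natCast]; exact hep
        · exact hmp d hd)
    refine hc1 (Nat.count Nat.Prime m) ⟨?_, ?_⟩ (Nat.nth_count hmprime)
    · rw [key k le_rfl]
      have : (⌊x⌋₊ : ℝ) ≤ x := Nat.floor_le (le_trans (by positivity) hmx)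
      refine le_trans ?_ this
      rw [mul_comm P]
      exact_mod_cast hmP
    · rw [hD, multiples]
      refine Finset.image_congr fun i hi => ?_
      have hi' : i ≤ k := (Finset.mem_Icc.1 hi).2
      have h0 := key 0 (Nat.zero_le _)
      simp only [add_zero, mul_zero] at h0
      simp only [key i hi', h0]
      push_cast; ring
  have h1 : primeTupleCount x (insert 0 D) ≤ _ := Set.ncard_le_ncard hsub (Finset.finite_toSet _)
  rw [Set.ncard_coe_finset] at h1
  refine h1.trans ((Finset.card_union_le _ _).trans (add_le_add
    ((Finset.card_union_le _ _).trans (add_le_add ?_ ?_)) ?_))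
  · refine Finset.card_image_le.trans (le_of_eq ?_)
    exact (Set.ncard_eq_toFinset_card _ hfin).symm
  · rw [Nat.card_Ioc]; omega
  · refine Finset.card_biUnion_le.trans (Finset.sum_le_sum fun e _ => le_of_eq ?_)
    exact (Set.ncard_eq_toFinset_card _ (hTf _)).symm

/-! ### The singular series -/

/-- The factor at `q` of the singular series of `E`. -/
noncomputable def localFactor (E : Finset ℤ) (q : ℕ) : ℝ :=
  ((1 - 1 / (q : ℝ)) ^ E.card)⁻¹ * (1 - (residueCount E q : ℝ) / (q : ℝ))

/-- The factor at `q > K` of the singular series of a set of `K` integers which are distinct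
modulo `q`. For the primes `q ≤ K` it is set to `1`, so that it never vanishes. -/
noncomputable def genericFactor (K q : ℕ) : ℝ :=
  if K < q then ((1 - 1 / (q : ℝ)) ^ K)⁻¹ * (1 - (K : ℝ) / (q : ℝ)) else 1

theorem one_div_prime_le {q : ℕ} (hq : q.Prime) : 0 < 1 / (q : ℝ) ∧ 1 / (q : ℝ) ≤ 1 / 2 := by
  have h2 : (2 : ℝ) ≤ q := by exact_mod_cast hq.two_le
  exact ⟨by positivity, one_div_le_one_div_of_le (by norm_num) h2⟩

/-- By Bernoulli's inequality, the generic factor at `q` lies between `1 - K ^ 2 / q ^ 2` and `1`,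
which makes the sum of the logarithms converge. -/
theorem genericFactor_bounds (K : ℕ) {q : ℕ} (hq : q.Prime) :
    0 < genericFactor K q ∧ genericFactor K q ≤ 1 ∧
      -(((K : ℝ) + 1) ^ 3 * (1 / (q : ℝ) ^ 2)) ≤ Real.log (genericFactor K q) := by
  obtain ⟨h1, h2⟩ := one_div_prime_le hq
  set s := 1 / (q : ℝ) with hs
  have hs2 : 1 / (q : ℝ) ^ 2 = s ^ 2 := by rw [hs, one_div_pow]
  rw [hs2]
  unfold genericFactor
  split_ifs with h
  · rw [← hs]
    have hq0 : (0 : ℝ) < q := by exact_mod_cast hq.pos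
    have e0 : (K : ℝ) / q = K * s := by rw [hs]; ring
    have e1 : (K : ℝ) * s ≤ K / (K + 1) := by
      rw [← e0]
      have : (K : ℝ) + 1 ≤ q := by exact_mod_cast h
      exact div_le_div_of_nonneg_left (by positivity) (by positivity) this
    have e2 : (K : ℝ) / (K + 1) < 1 := by rw [div_lt_one (by positivity)]; linarith
    have hpow : 0 < (1 - s) ^ K := pow_pos (by linarith) K
    have hb : 1 - K * s ≤ (1 - s) ^ K := by
      have := one_add_mul_le_pow (a := -s) (by linarith) K
      calc 1 - K * s = 1 + K * -s := by ring
        _ ≤ (1 + -s) ^ K := this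
        _ = _ := by ring
    have hb2 : 1 + K * s ≤ ((1 - s) ^ K)⁻¹ := by
      have := one_add_mul_le_pow (a := s) (by linarith) K
      refine this.trans ?_
      rw [← inv_pow]
      refine pow_le_pow_left₀ (by linarith) ?_ K
      rw [← one_div (1 - s), le_div_iff₀ (by linarith)]
      nlinarith
    rw [e0]
    have hg0 : 0 < ((1 - s) ^ K)⁻¹ * (1 - K * s) := mul_pos (inv_pos.2 hpow) (by linarith)
    refine ⟨hg0, ?_, ?_⟩
    · rw [inv_mul_eq_div, div_le_one hpow]; exact hb
    · set g := ((1 - s) ^ K)⁻¹ * (1 - K * s) with hg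
      have hglow : 1 - (K * s) ^ 2 ≤ g := by
        have : (1 + K * s) * (1 - K * s) ≤ g := mul_le_mul_of_nonneg_right hb2 (by linarith)
        linarith [this]
      have hdelta : 1 / ((K : ℝ) + 1) ≤ 1 - (K * s) ^ 2 := by
        have e3 : (K * s) ^ 2 ≤ K / (K + 1) := by
          have e4 : (0 : ℝ) ≤ K * s := by positivity
          nlinarith
        have e5 : 1 - (K : ℝ) / (K + 1) = 1 / (K + 1) := by field_simp; ring
        linarith
      have hlog := Real.one_sub_inv_le_log_of_pos hg0
      refine le_trans ?_ hlog
      have hinv : g⁻¹ ≤ K + 1 := by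
        rw [inv_le_comm₀ hg0 (by positivity), ← one_div]
        linarith
      have e6 : 1 - g⁻¹ = -((1 - g) * g⁻¹) := by field_simp; ring
      rw [e6]
      apply neg_le_neg
      have e7 : (0 : ℝ) ≤ K := by positivity
      calc (1 - g) * g⁻¹ ≤ (K * s) ^ 2 * (K + 1) :=
            mul_le_mul (by linarith) hinv (by positivity) (by positivity)
        _ = (K ^ 2 * (K + 1)) * s ^ 2 := by ring
        _ ≤ (K + 1) ^ 3 * s ^ 2 := by
            refine mul_le_mul_of_nonneg_right ?_ (by positivity)
            nlinarith
  · refine ⟨one_pos, le_rfl, ?_⟩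
    rw [Real.log_one]
    have : (0 : ℝ) ≤ (K + 1) ^ 3 * s ^ 2 := by positivity
    linarith

/-- The generic factors have a convergent product with a positive value. It serves as the reference
to which all singular series are compared. -/
theorem exists_hasProd_genericFactor (K : ℕ) :
    ∃ T : ℝ, 0 < T ∧ HasProd (fun q : Nat.Primes => genericFactor K q) T := by
  have hsum : Summable fun q : Nat.Primes => Real.log (genericFactor K q) := by
    have h0 : Summable fun q : Nat.Primes => ((K : ℝ) + 1) ^ 3 * (1 / ((q : ℕ) : ℝ) ^ 2) :=
      ((Real.summable_one_div_nat_pow.2 one_lt_two).comp_injective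
        (Subtype.val_injective (p := Nat.Prime))).mul_left _
    refine Summable.of_norm_bounded h0 fun q => ?_
    obtain ⟨h1, h2, h3⟩ := genericFactor_bounds K q.2
    have h4 := Real.log_nonpos h1.le h2
    rw [Real.norm_eq_abs, abs_of_nonpos h4]
    linarith
  exact ⟨_, Real.exp_pos _, Real.hasProd_of_hasSum_log
    (fun q => (genericFactor_bounds K q.2).1) hsum.hasSum⟩

/-- As almost all factors of a singular series are generic, it is a finite modification of the
product of the generic factors. This covers the case in which a factor vanishes. -/
theorem singularSeries_eq_mul_prod {E : Finset ℤ} {T : ℝ}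
    (hT : HasProd (fun q : Nat.Primes => genericFactor E.card q) T) {F : Finset ℕ}
    (hF : ∀ q ∈ F, q.Prime)
    (hFc : ∀ q : ℕ, q.Prime → q ∉ F → E.card < q ∧ residueCount E q = E.card) :
    singularSeries E = T * ∏ q ∈ F, localFactor E q / genericFactor E.card q := by
  have h1 : HasProd (fun q : Nat.Primes => localFactor E q / genericFactor E.card q)
      (∏ q ∈ F, localFactor E q / genericFactor E.card q) := by
    rw [← Finset.prod_subtype_of_mem (p := Nat.Prime) _ hF]
    refine hasProd_prod_of_ne_finset_one fun q hq => ?_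
    obtain ⟨h2, h3⟩ := hFc q q.2 (fun h => hq (Finset.mem_subtype.2 h))
    rw [div_eq_one_iff_eq (genericFactor_bounds _ q.2).1.ne', localFactor, genericFactor,
      if_pos h2, h3]
  have h2 := hT.mul h1
  refine Eq.trans ?_ h2.tprod_eq
  refine tprod_congr fun q => ?_
  rw [mul_div_cancel₀ _ (genericFactor_bounds _ q.2).1.ne']
  rfl

theorem residueCount_le_card (E : Finset ℤ) (q : ℕ) : residueCount E q ≤ E.card :=
  Finset.card_image_le

theorem residueCount_le_self (E : Finset ℤ) {q : ℕ} (hq : 0 < q) : residueCount E q ≤ q := by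
  have : NeZero q := ⟨hq.ne'⟩
  exact (Finset.card_le_univ _).trans (ZMod.card q).le

theorem one_le_residueCount {E : Finset ℤ} (hE : E.Nonempty) (q : ℕ) : 1 ≤ residueCount E q :=
  Finset.card_pos.2 (hE.image _)

theorem two_le_residueCount {E : Finset ℤ} {q : ℕ} {a b : ℤ} (ha : a ∈ E) (hb : b ∈ E)
    (h : ¬ (q : ℤ) ∣ b - a) : 2 ≤ residueCount E q := by
  refine Finset.one_lt_card.2 ⟨_, Finset.mem_image_of_mem _ ha, _, Finset.mem_image_of_mem _ hb, ?_⟩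
  rwa [Ne, ZMod.intCast_eq_intCast_iff_dvd_sub]

theorem residueCount_eq_one {E : Finset ℤ} (hE : E.Nonempty) {q : ℕ}
    (h : ∀ a ∈ E, (q : ℤ) ∣ a) : residueCount E q = 1 := by
  refine le_antisymm (Finset.card_le_one.2 ?_) (one_le_residueCount hE q)
  intro u hu v hv
  obtain ⟨a, ha, rfl⟩ := Finset.mem_image.1 hu
  obtain ⟨b, hb, rfl⟩ := Finset.mem_image.1 hv
  rw [(ZMod.intCast_zmod_eq_zero_iff_dvd a q).2 (h a ha),
    (ZMod.intCast_zmod_eq_zero_iff_dvd b q).2 (h b hb)]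

theorem residueCount_eq_card {E : Finset ℤ} {q : ℕ}
    (h : ∀ a ∈ E, ∀ b ∈ E, (q : ℤ) ∣ b - a → a = b) : residueCount E q = E.card :=
  Finset.card_image_of_injOn fun a ha b hb hab =>
    h a ha b hb ((ZMod.intCast_eq_intCast_iff_dvd_sub a b q).1 hab)

/-- The product of the distances between the elements of `E` (each pair taken twice). -/
def differenceProduct (E : Finset ℤ) : ℕ := ∏ t ∈ E.offDiag, (t.2 - t.1).natAbs

theorem differenceProduct_ne_zero (E : Finset ℤ) : differenceProduct E ≠ 0 := by
  refine Finset.prod_ne_zero_iff.2 fun t ht => ?_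
  have := (Finset.mem_offDiag.1 ht).2.2
  omega

theorem residueCount_eq_card_of_not_dvd {E : Finset ℤ} {q : ℕ}
    (h : ¬ q ∣ differenceProduct E) : residueCount E q = E.card := by
  refine residueCount_eq_card fun a ha b hb hab => ?_
  by_contra hne
  refine h ((Int.natCast_dvd.1 hab).trans ?_)
  exact Finset.dvd_prod_of_mem (fun t : ℤ × ℤ => (t.2 - t.1).natAbs)
    (Finset.mem_offDiag.2 ⟨ha, hb, hne⟩ : (a, b) ∈ E.offDiag)

theorem localFactor_nonneg (E : Finset ℤ) {q : ℕ} (hq : q.Prime) : 0 ≤ localFactor E q := by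
  have h1 := one_div_prime_le hq
  have h2 : (residueCount E q : ℝ) ≤ q := by exact_mod_cast residueCount_le_self E hq.pos
  have h3 : (residueCount E q : ℝ) / q ≤ 1 := div_le_one_of_le₀ h2 (by positivity)
  exact mul_nonneg (inv_nonneg.2 (pow_nonneg (by linarith) _)) (by linarith)

theorem exists_residueCount_eq_of_singularSeries_eq_zero {E : Finset ℤ}
    (h : singularSeries E = 0) : ∃ q : ℕ, q.Prime ∧ residueCount E q = q := by
  obtain ⟨T, hT0, hT⟩ := exists_hasProd_genericFactor E.card
  have hS := singularSeries_eq_mul_prod hT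
    (F := (Finset.range (E.card + 1)).filter Nat.Prime ∪ (differenceProduct E).primeFactors)
    (by
      intro q hq
      rcases Finset.mem_union.1 hq with hq | hq
      · exact (Finset.mem_filter.1 hq).2
      · exact Nat.prime_of_mem_primeFactors hq)
    (by
      intro q hq hqF
      simp only [Finset.mem_union, Finset.mem_filter, Finset.mem_range, Nat.mem_primeFactors,
        not_or, not_and] at hqF
      refine ⟨?_, residueCount_eq_card_of_not_dvd fun hd =>
        hqF.2 hq hd (differenceProduct_ne_zero E)⟩
      by_contra hle
      exact hqF.1 (by omega) hq)
  rw [h] at hS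
  rcases mul_eq_zero.1 hS.symm with h0 | h0
  · exact absurd h0 hT0.ne'
  · obtain ⟨q, hqF, hq0⟩ := Finset.prod_eq_zero_iff.1 h0
    have hq : q.Prime := by
      rcases Finset.mem_union.1 hqF with hq | hq
      · exact (Finset.mem_filter.1 hq).2
      · exact Nat.prime_of_mem_primeFactors hq
    refine ⟨q, hq, ?_⟩
    have h1 := one_div_prime_le hq
    have hq1 : (0 : ℝ) < q := by exact_mod_cast hq.pos
    rcases div_eq_zero_iff.1 hq0 with h2 | h2
    · rcases mul_eq_zero.1 h2 with h3 | h3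
      · exact absurd h3 (inv_ne_zero (pow_ne_zero _ (by linarith)))
      · have h4 : (residueCount E q : ℝ) / q = 1 := by linarith
        rw [div_eq_one_iff_eq hq1.ne'] at h4
        exact_mod_cast h4
    · exact absurd h2 (genericFactor_bounds _ hq).1.ne'

/-- If all residue classes modulo a prime `q` are occupied by `E`, then a translate of `E` by `m`
contains a multiple of `q`, and so consists of primes only for few `m`. -/
theorem primeTupleCount_le_card_of_residueCount_eq {E : Finset ℤ} (hE : ∀ e ∈ E, 0 ≤ e) {q : ℕ}
    (hq : q.Prime) (hqE : residueCount E q = q) (x : ℝ) : primeTupleCount x E ≤ E.card := by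
  have : NeZero q := ⟨hq.pos.ne'⟩
  have hqc : q ≤ E.card := hqE ▸ residueCount_le_card E q
  have huniv : E.image (fun d : ℤ => (d : ZMod q)) = Finset.univ :=
    Finset.eq_univ_of_card _ (hqE.trans (ZMod.card q).symm)
  have hsub : {m : ℕ | 0 < m ∧ (m : ℝ) ≤ x ∧ ∀ d ∈ E, Nat.Prime ((m : ℤ) + d).toNat} ⊆
      (Finset.Icc 1 E.card : Finset ℕ) := by
    rintro m ⟨hm0, _, hm⟩
    obtain ⟨e, he, hem⟩ := Finset.mem_image.1
      (huniv ▸ Finset.mem_univ (-(m : ZMod q)) : -(m : ZMod q) ∈ E.image _)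
    have h1 := hE e he
    have h2 : ((((m : ℤ) + e).toNat : ℕ) : ℤ) = m + e := Int.toNat_of_nonneg (by omega)
    have h3 : q ∣ ((m : ℤ) + e).toNat := by
      rw [← Int.natCast_dvd_natCast, h2, ← ZMod.intCast_zmod_eq_zero_iff_dvd]
      push_cast
      rw [hem]; ring
    have h4 := (Nat.prime_dvd_prime_iff_eq hq (hm e he)).1 h3
    rw [Finset.coe_Icc, Set.mem_Icc]
    omega
  have h1 := Set.ncard_le_ncard hsub (Finset.finite_toSet _)
  rw [Set.ncard_coe_finset, Nat.card_Icc] at h1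
  exact h1

/-! ### Singular series of multiples of primorials -/

theorem zero_notMem_multiples (k : ℕ) {P : ℕ} (hP : 0 < P) : (0 : ℤ) ∉ multiples k P := by
  intro h
  have := (le_of_mem_multiples h).1
  omega

theorem card_insert_zero_multiples (k : ℕ) {P : ℕ} (hP : 0 < P) :
    (insert 0 (multiples k P)).card = k + 1 := by
  rw [Finset.card_insert_of_notMem (zero_notMem_multiples k hP), card_multiples k hP]

theorem mem_insert_zero_multiples {k P : ℕ} {a : ℤ} (ha : a ∈ insert 0 (multiples k P)) :
    ∃ i : ℕ, i ≤ k ∧ a = P * i := by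
  rcases Finset.mem_insert.1 ha with rfl | ha
  · exact ⟨0, Nat.zero_le _, by simp⟩
  · obtain ⟨i, hi, rfl⟩ := Finset.mem_image.1 ha
    exact ⟨i, (Finset.mem_Icc.1 hi).2, rfl⟩

theorem residueCount_multiples_primorial_of_le (k : ℕ) {y q : ℕ} (hq : q.Prime) (hqy : q ≤ y) :
    residueCount (insert 0 (multiples k (primorial y))) q = 1 := by
  refine residueCount_eq_one (Finset.insert_nonempty _ _) fun a ha => ?_
  obtain ⟨i, -, rfl⟩ := mem_insert_zero_multiples ha
  exact Dvd.dvd.mul_right (by exact_mod_cast (hq.dvd_primorial_iff).2 hqy) _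

theorem residueCount_multiples_primorial_of_lt {k y q : ℕ} (hq : q.Prime) (hky : k ≤ y)
    (hqy : y < q) : residueCount (insert 0 (multiples k (primorial y))) q =
      (insert 0 (multiples k (primorial y))).card := by
  refine residueCount_eq_card fun a ha b hb hab => ?_
  obtain ⟨i, hi, rfl⟩ := mem_insert_zero_multiples ha
  obtain ⟨j, hj, rfl⟩ := mem_insert_zero_multiples hb
  rw [← mul_sub] at hab
  rcases (Nat.prime_iff_prime_int.1 hq).dvd_or_dvd hab with h | h
  · have := (hq.dvd_primorial_iff).1 (Int.natCast_dvd_natCast.1 h)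
    omega
  · have := Int.eq_zero_of_abs_lt_dvd h (by rw [abs_lt]; constructor <;> omega)
    have : i = j := by omega
    rw [this]

theorem singularSeries_multiples_primorial {k y : ℕ} (hky : k + 1 ≤ y) {T : ℝ}
    (hT : HasProd (fun q : Nat.Primes => genericFactor (k + 1) q) T) :
    singularSeries (insert 0 (multiples k (primorial y))) = T * ∏ q ∈ y.primesLE,
      ((1 - 1 / (q : ℝ)) ^ (k + 1))⁻¹ * (1 - 1 / (q : ℝ)) / genericFactor (k + 1) q := by
  have hcard := card_insert_zero_multiples k (primorial_pos y)
  rw [← hcard] at hT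
  rw [singularSeries_eq_mul_prod hT (F := y.primesLE) (fun q hq => Nat.prime_of_mem_primesLE hq)]
  · rw [hcard]
    refine congrArg _ (Finset.prod_congr rfl fun q hq => ?_)
    rw [localFactor, hcard, residueCount_multiples_primorial_of_le k
      (Nat.prime_of_mem_primesLE hq) (Nat.le_of_mem_primesLE hq)]
    simp
  · intro q hq hqy
    have hqy' : y < q := by
      by_contra h
      exact hqy (Nat.mem_primesLE.2 ⟨by omega, hq⟩)
    exact ⟨by omega, residueCount_multiples_primorial_of_lt hq (by omega) hqy'⟩

/-- The singular series of `{0, P, …, kP}`, with `P` the primorial of `y`, tends to infinity with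
`y`. -/
theorem mul_log_le_singularSeries_multiples {k y : ℕ} (hk : 1 ≤ k) (hky : k + 1 ≤ y) {T : ℝ}
    (hT0 : 0 < T) (hT : HasProd (fun q : Nat.Primes => genericFactor (k + 1) q) T) :
    T * Real.log y ≤ singularSeries (insert 0 (multiples k (primorial y))) := by
  rw [singularSeries_multiples_primorial hky hT]
  refine mul_le_mul_of_nonneg_left ?_ hT0.le
  have h1 : Real.log y ≤ Real.log ((y + 1 : ℕ) : ℝ) :=
    Real.log_le_log (by exact_mod_cast (by omega : 0 < y)) (by push_cast; linarith)
  refine (h1.trans (log_le_prod_primesBelow (by omega))).trans ?_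
  refine Finset.prod_le_prod (fun q hq => inv_nonneg.2 ?_) fun q hq => ?_
  · linarith [(one_div_prime_le (Nat.prime_of_mem_primesBelow hq)).2]
  · have hq' := Nat.prime_of_mem_primesBelow hq
    have hs := one_div_prime_le hq'
    obtain ⟨g1, g2, -⟩ := genericFactor_bounds (k + 1) hq'
    set s := 1 / (q : ℝ)
    have hs1 : 0 < 1 - s := by linarith
    have e1 : ((1 - s) ^ (k + 1))⁻¹ * (1 - s) = ((1 - s) ^ k)⁻¹ := by
      rw [pow_succ]; field_simp
    rw [e1, le_div_iff₀ g1]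
    calc (1 - s)⁻¹ * genericFactor (k + 1) q ≤ (1 - s)⁻¹ * 1 := by gcongr
      _ = ((1 - s) ^ 1)⁻¹ := by simp
      _ ≤ ((1 - s) ^ k)⁻¹ := by
        refine inv_anti₀ (pow_pos hs1 _) ?_
        exact pow_le_pow_of_le_one hs1.le (by linarith) hk

/-- A nonzero `n` has at most `log n / log y` prime factors exceeding `y`. -/
theorem card_large_primeFactors_mul_log_le {n y : ℕ} (hn : n ≠ 0) (hy : 1 ≤ y) :
    ((n.primeFactors.filter (y < ·)).card : ℝ) * Real.log y ≤ Real.log n := by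
  have h1 : y ^ (n.primeFactors.filter (y < ·)).card ≤ n := by
    calc y ^ (n.primeFactors.filter (y < ·)).card
        ≤ ∏ q ∈ n.primeFactors.filter (y < ·), q := by
          rw [← Finset.prod_const]
          exact Finset.prod_le_prod' fun q hq => (Finset.mem_filter.1 hq).2.le
      _ ≤ ∏ q ∈ n.primeFactors, q := Nat.le_of_dvd
          (Finset.prod_pos fun q hq => (Nat.prime_of_mem_primeFactors hq).pos)
          (Finset.prod_dvd_prod_of_subset _ _ _ (Finset.filter_subset _ _))
      _ ≤ n := Nat.le_of_dvd (Nat.pos_of_ne_zero hn) (Nat.prod_primeFactors_dvd n)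
  rw [← Real.log_pow]
  have hy' : (0 : ℝ) < y := by exact_mod_cast hy
  exact Real.log_le_log (by positivity) (by exact_mod_cast h1)

theorem log_differenceProduct_le {E : Finset ℤ} {B : ℝ} (hB : 1 ≤ B)
    (hEB : ∀ a ∈ E, ∀ b ∈ E, |((b - a : ℤ) : ℝ)| ≤ B) :
    Real.log (differenceProduct E) ≤ (E.card : ℝ) ^ 2 * Real.log B := by
  have h1 : (differenceProduct E : ℝ) ≤ B ^ (E.card ^ 2) := by
    rw [differenceProduct, Nat.cast_prod]
    calc ∏ t ∈ E.offDiag, ((t.2 - t.1).natAbs : ℝ) ≤ ∏ t ∈ E.offDiag, B := by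
          refine Finset.prod_le_prod (fun _ _ => Nat.cast_nonneg _) fun t ht => ?_
          obtain ⟨ha, hb, -⟩ := Finset.mem_offDiag.1 ht
          rw [Nat.cast_natAbs, Int.cast_abs]
          exact hEB _ ha _ hb
      _ = B ^ E.offDiag.card := Finset.prod_const _
      _ ≤ B ^ (E.card ^ 2) := by
          refine pow_le_pow_right₀ hB ?_
          rw [Finset.offDiag_card, sq]
          omega
  calc Real.log (differenceProduct E) ≤ Real.log (B ^ (E.card ^ 2)) :=
        Real.log_le_log (by exact_mod_cast Nat.pos_of_ne_zero (differenceProduct_ne_zero E)) h1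
    _ = _ := by rw [Real.log_pow]; push_cast; ring

/-- The comparison of the singular series of `{0} ∪ D` with that of the multiples of a primorial,
for a set `D` not all of whose elements are divisible by `p`. The exponential accounts for the
primes beyond `y` which divide a difference of two elements of `{0} ∪ D`. -/
theorem singularSeries_le_of_not_dvd {k y p : ℕ} (hky : 2 * (k + 1) ≤ y) (hp : p.Prime)
    (hpy : p ≤ y) {D : Finset ℤ} (hD : D.card = k) (h0 : (0 : ℤ) ∉ D) {d : ℤ} (hd : d ∈ D)
    (hpd : ¬ (p : ℤ) ∣ d) {B : ℝ} (hB : 1 ≤ B)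
    (hDB : ∀ a ∈ insert 0 D, ∀ b ∈ insert 0 D, |((b - a : ℤ) : ℝ)| ≤ B) :
    singularSeries (insert 0 D) ≤ ((p - 2) / (p - 1)) *
      Real.exp (2 * k * ((k + 1) ^ 2 * Real.log B / (y * Real.log y))) *
      singularSeries (insert 0 (multiples k (primorial y))) := by
  obtain ⟨T, hT0, hT⟩ := exists_hasProd_genericFactor (k + 1)
  set E := insert 0 D with hE
  have hcard : E.card = k + 1 := by rw [hE, Finset.card_insert_of_notMem h0, hD]
  have hne : E.Nonempty := Finset.insert_nonempty _ _
  set Δ := differenceProduct E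
  have hΔ : Δ ≠ 0 := differenceProduct_ne_zero E
  set G := Δ.primeFactors.filter (y < ·) with hG
  have hGp : ∀ q ∈ G, q.Prime ∧ y < q := fun q hq =>
    ⟨Nat.prime_of_mem_primeFactors (Finset.mem_filter.1 hq).1, (Finset.mem_filter.1 hq).2⟩
  have hdisj : Disjoint y.primesLE G := by
    rw [Finset.disjoint_left]
    intro q h1 h2
    have := Nat.le_of_mem_primesLE h1
    have := (hGp q h2).2
    omega
  have hS : singularSeries E =
      T * ∏ q ∈ y.primesLE ∪ G, localFactor E q / genericFactor (k + 1) q := by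
    rw [← hcard] at hT ⊢
    refine singularSeries_eq_mul_prod hT ?_ ?_
    · intro q hq
      rcases Finset.mem_union.1 hq with h | h
      · exact Nat.prime_of_mem_primesLE h
      · exact (hGp q h).1
    · intro q hq hqF
      simp only [Finset.mem_union, Nat.mem_primesLE, hG, Finset.mem_filter, Nat.mem_primeFactors,
        not_or, not_and] at hqF
      have hqy : y < q := by
        by_contra h
        exact hqF.1 (by omega) hq
      exact ⟨by omega, residueCount_eq_card_of_not_dvd fun h => hqF.2 ⟨hq, h, hΔ⟩ hqy⟩
  rw [hS, singularSeries_multiples_primorial (by omega) hT, Finset.prod_union hdisj]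
  set ρ : ℝ := (p - 2) / (p - 1) with hρ
  have hp2 : (2 : ℝ) ≤ p := by exact_mod_cast hp.two_le
  have hρ0 : 0 ≤ ρ := div_nonneg (by linarith) (by linarith)
  have hsmall : ∏ q ∈ y.primesLE, localFactor E q / genericFactor (k + 1) q ≤
      ρ * ∏ q ∈ y.primesLE,
        ((1 - 1 / (q : ℝ)) ^ (k + 1))⁻¹ * (1 - 1 / (q : ℝ)) / genericFactor (k + 1) q := by
    have e1 : ∏ q ∈ y.primesLE, (if q = p then ρ else 1) = ρ := by
      rw [Finset.prod_ite_eq', if_pos (Nat.mem_primesLE.2 ⟨hpy, hp⟩)]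
    rw [← e1, ← Finset.prod_mul_distrib]
    refine Finset.prod_le_prod (fun q hq => ?_) fun q hq => ?_
    · have hq' := Nat.prime_of_mem_primesLE hq
      exact div_nonneg (localFactor_nonneg E hq') (genericFactor_bounds _ hq').1.le
    · have hq' := Nat.prime_of_mem_primesLE hq
      have hg := (genericFactor_bounds (k + 1) hq').1
      have hs := one_div_prime_le hq'
      rw [← mul_div_assoc]
      refine div_le_div_of_nonneg_right ?_ hg.le
      rw [mul_left_comm, localFactor, hcard]
      refine mul_le_mul_of_nonneg_left ?_ (inv_nonneg.2 (pow_nonneg (by linarith) _))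
      have hq0 : (0 : ℝ) < q := by exact_mod_cast hq'.pos
      split_ifs with h
      · subst h
        have h2 : (2 : ℝ) ≤ residueCount E q := by
          exact_mod_cast two_le_residueCount (Finset.mem_insert_self _ _)
            (Finset.mem_insert_of_mem hd) (by simpa using hpd)
        have e2 : ρ * (1 - 1 / (q : ℝ)) = 1 - 2 / q := by
          have : (q : ℝ) - 1 ≠ 0 := by linarith
          rw [hρ]; field_simp
        rw [e2]
        exact sub_le_sub_left (div_le_div_of_nonneg_right h2 hq0.le) _
      · have h2 : (1 : ℝ) ≤ residueCount E q := by exact_mod_cast one_le_residueCount hne q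
        rw [one_mul]
        exact sub_le_sub_left (div_le_div_of_nonneg_right h2 hq0.le) _
  have hy0 : (0 : ℝ) < y := by exact_mod_cast (by omega : 0 < y)
  have hlarge : ∏ q ∈ G, localFactor E q / genericFactor (k + 1) q ≤
      Real.exp (2 * k * ((k + 1) ^ 2 * Real.log B / (y * Real.log y))) := by
    have e1 : ∀ q ∈ G, localFactor E q / genericFactor (k + 1) q ≤ Real.exp (2 * k / y) := by
      intro q hq
      obtain ⟨hq', hyq⟩ := hGp q hq
      have hs := one_div_prime_le hq'
      have hq0 : (0 : ℝ) < q := by exact_mod_cast hq'.pos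
      have hyq' : (y : ℝ) < q := by exact_mod_cast hyq
      have hky' : (2 : ℝ) * (k + 1) ≤ y := by exact_mod_cast hky
      have h1 : (1 : ℝ) ≤ residueCount E q := by exact_mod_cast one_le_residueCount hne q
      rw [localFactor, genericFactor, if_pos (by omega), hcard,
        mul_div_mul_left _ _ (inv_ne_zero (pow_ne_zero _ (by linarith)))]
      have e2 : (0 : ℝ) < 1 - ((k + 1 : ℕ) : ℝ) / q := by
        rw [sub_pos, div_lt_one hq0]; push_cast; linarith
      have e3 : (1 - (residueCount E q : ℝ) / q) / (1 - ((k + 1 : ℕ) : ℝ) / q) ≤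
          1 + 2 * k / y := by
        rw [div_le_iff₀ e2]
        have e4 : 1 - (residueCount E q : ℝ) / q ≤ 1 - 1 / q :=
          sub_le_sub_left (div_le_div_of_nonneg_right h1 hq0.le) _
        refine e4.trans ?_
        push_cast
        have e5 : (1 + 2 * k / y) * (1 - ((k : ℝ) + 1) / q) - (1 - 1 / q)
            = k * (2 * (q - (k + 1)) - y) / (y * q) := by field_simp; ring
        have e6 : 0 ≤ k * (2 * (q - ((k : ℝ) + 1)) - y) / (y * q) :=
          div_nonneg (mul_nonneg (Nat.cast_nonneg k) (by linarith)) (by positivity)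
        linarith
      refine e3.trans ?_
      linarith [Real.add_one_le_exp (2 * k / y : ℝ)]
    have hy1 : (1 : ℝ) < y := by exact_mod_cast (by omega : 1 < y)
    have hlogy : 0 < Real.log y := Real.log_pos hy1
    have e2 : (G.card : ℝ) ≤ (k + 1) ^ 2 * Real.log B / Real.log y := by
      rw [le_div_iff₀ hlogy]
      refine (card_large_primeFactors_mul_log_le hΔ (by omega)).trans ?_
      have := log_differenceProduct_le hB hDB
      rw [hcard] at this
      exact_mod_cast this
    calc ∏ q ∈ G, localFactor E q / genericFactor (k + 1) q
        ≤ ∏ q ∈ G, Real.exp (2 * k / y) := Finset.prod_le_prod (fun q hq =>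
          div_nonneg (localFactor_nonneg E (hGp q hq).1) (genericFactor_bounds _ (hGp q hq).1).1.le)
          e1
      _ = Real.exp (G.card * (2 * k / y)) := by rw [Finset.prod_const, ← Real.exp_nat_mul]
      _ ≤ _ := by
        apply Real.exp_le_exp.2
        calc (G.card : ℝ) * (2 * k / y)
            ≤ ((k + 1) ^ 2 * Real.log B / Real.log y) * (2 * k / y) := by gcongr
          _ = _ := by field_simp
  set V := ∏ q ∈ y.primesLE,
    ((1 - 1 / (q : ℝ)) ^ (k + 1))⁻¹ * (1 - 1 / (q : ℝ)) / genericFactor (k + 1) q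
  have hV0 : 0 ≤ V := Finset.prod_nonneg fun q hq => by
    have hq' := Nat.prime_of_mem_primesLE hq
    have hs := one_div_prime_le hq'
    exact div_nonneg (mul_nonneg (inv_nonneg.2 (pow_nonneg (by linarith) _)) (by linarith))
      (genericFactor_bounds _ hq').1.le
  calc T * ((∏ q ∈ y.primesLE, localFactor E q / genericFactor (k + 1) q) *
        ∏ q ∈ G, localFactor E q / genericFactor (k + 1) q)
      ≤ T * ((ρ * V) *
        Real.exp (2 * k * ((k + 1) ^ 2 * Real.log B / (y * Real.log y)))) := by
        refine mul_le_mul_of_nonneg_left (mul_le_mul hsmall hlarge ?_ (by positivity)) hT0.le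
        exact Finset.prod_nonneg fun q hq => div_nonneg (localFactor_nonneg E (hGp q hq).1)
          (genericFactor_bounds _ (hGp q hq).1).1.le
    _ = _ := by ring

/-! ### Jumping champions -/

/-- The sieve bound applied to all the tuples obtained by adding one element to
`{0, P, 2P, …, kP}`. -/
theorem eventually_sum_primeTupleCount_le (k : ℕ) {δ : ℝ} (hδ : 0 < δ) :
    ∀ᶠ x : ℝ in atTop, ∀ P : ℕ, 0 < P →
      ((k * P : ℕ) : ℝ) ≤ Real.log x ^ (1 / (4 * ((k : ℝ) + 2))) →
      ∑ e ∈ Finset.Icc (1 : ℤ) (k * P) \ multiples k P,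
        (primeTupleCount x (insert e (insert 0 (multiples k P))) : ℝ) ≤
        δ * (x / Real.log x ^ (k + 1)) := by
  filter_upwards [eventually_primeTupleCount_mul_le (k + 1) hδ, eventually_gt_atTop 1]
    with x hx hx1 P hP hkP
  have e0 : (1 / (4 * (((k + 1 : ℕ) : ℝ) + 1))) = 1 / (4 * ((k : ℝ) + 2)) := by
    push_cast; ring_nf
  rw [e0] at hx
  set t := Real.log x
  have ht : 0 < t := Real.log_pos hx1
  set c : ℝ := 1 / (4 * ((k : ℝ) + 2))
  have htc : 0 < t ^ c := Real.rpow_pos_of_pos ht c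
  have h1 : ∀ e ∈ Finset.Icc (1 : ℤ) (k * P) \ multiples k P,
      (primeTupleCount x (insert e (insert 0 (multiples k P))) : ℝ) ≤
        δ * (x / t ^ (k + 1)) / t ^ c := by
    intro e he
    obtain ⟨he1, he2⟩ := Finset.mem_sdiff.1 he
    rw [Finset.mem_Icc] at he1
    have hbd : ∀ a ∈ insert e (insert 0 (multiples k P)), 0 ≤ a ∧ a ≤ k * P := by
      intro a ha
      rcases Finset.mem_insert.1 ha with rfl | ha
      · exact ⟨by omega, he1.2⟩
      · rcases Finset.mem_insert.1 ha with rfl | ha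
        · exact ⟨le_rfl, by positivity⟩
        · have := le_of_mem_multiples ha
          exact ⟨by omega, this.2⟩
    have hcard : (insert e (insert 0 (multiples k P))).card = k + 1 + 1 := by
      rw [Finset.card_insert_of_notMem, card_insert_zero_multiples k hP]
      rw [Finset.mem_insert, not_or]
      exact ⟨by omega, he2⟩
    have := hx _ hcard (fun a ha => ⟨(hbd a ha).1, le_trans
      (by have := (hbd a ha).2; exact_mod_cast this) hkP⟩)
    rw [le_div_iff₀ htc, ← mul_div_assoc, le_div_iff₀ (by positivity)]
    linarith
  have h2 : ((Finset.Icc (1 : ℤ) (k * P) \ multiples k P).card : ℝ) ≤ t ^ c := by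
    refine le_trans ?_ hkP
    have h3 := Finset.card_le_card (Finset.sdiff_subset :
      Finset.Icc (1 : ℤ) (k * P) \ multiples k P ⊆ _)
    rw [Int.card_Icc] at h3
    have h4 : ((k : ℤ) * P + 1 - 1).toNat = k * P := by
      rw [add_sub_cancel_right, ← Nat.cast_mul, Int.toNat_natCast]
    rw [h4] at h3
    exact_mod_cast h3
  refine (Finset.sum_le_sum h1).trans ?_
  rw [Finset.sum_const, nsmul_eq_mul]
  have hx0 : 0 < x := by linarith
  calc _ ≤ t ^ c * (δ * (x / t ^ (k + 1)) / t ^ c) := by gcongr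
    _ = _ := by field_simp

/-- For `y = ⌊(c / 4) log log x⌋` the primorial of `y` is small, while `y` is still of the order of
`log log x`. -/
theorem eventually_primorial_bounds {k : ℕ} {c : ℝ} (hc : 0 < c) :
    ∀ᶠ x : ℝ in atTop, ((k * primorial ⌊c / 4 * Real.log (Real.log x)⌋₊ : ℕ) : ℝ) ≤
        Real.log x ^ c ∧
      c / 8 * Real.log (Real.log x) ≤ (⌊c / 4 * Real.log (Real.log x)⌋₊ : ℝ) := by
  have ev1 : ∀ᶠ t : ℝ in atTop, (k : ℝ) ≤ t ^ (c / 2) :=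
    (tendsto_rpow_atTop (by linarith)).eventually_ge_atTop _
  have ev2 : ∀ᶠ t : ℝ in atTop, 8 / c ≤ Real.log t := Real.tendsto_log_atTop.eventually_ge_atTop _
  filter_upwards [Real.tendsto_log_atTop.eventually
    (ev1.and (ev2.and (eventually_gt_atTop 1)))] with x hx
  obtain ⟨h1, h2, h3⟩ := hx
  set t := Real.log x
  have ht : 0 < t := by linarith
  have hl : 0 < Real.log t := Real.log_pos h3
  have hfl : (⌊c / 4 * Real.log t⌋₊ : ℝ) ≤ c / 4 * Real.log t := Nat.floor_le (by positivity)
  have hfl2 := Nat.lt_floor_add_one (c / 4 * Real.log t)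
  set y := ⌊c / 4 * Real.log t⌋₊
  constructor
  · have e1 : (primorial y : ℝ) ≤ (4 : ℝ) ^ y := by exact_mod_cast primorial_le_four_pow y
    have e2 : (4 : ℝ) ^ y ≤ t ^ (c / 2) := by
      have e3 : (4 : ℝ) ≤ Real.exp 2 := by
        have : (2 : ℝ) ≤ Real.exp 1 := by linarith [Real.add_one_le_exp 1]
        calc (4 : ℝ) ≤ Real.exp 1 * Real.exp 1 := by nlinarith
          _ = Real.exp 2 := by rw [← Real.exp_add]; norm_num
      calc (4 : ℝ) ^ y ≤ (Real.exp 2) ^ y := pow_le_pow_left₀ (by norm_num) e3 _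
        _ = Real.exp (y * 2) := (Real.exp_nat_mul _ _).symm
        _ ≤ Real.exp (Real.log t * (c / 2)) := Real.exp_le_exp.2 (by linarith)
        _ = t ^ (c / 2) := (Real.rpow_def_of_pos ht _).symm
    push_cast
    calc (k : ℝ) * primorial y ≤ t ^ (c / 2) * t ^ (c / 2) :=
          mul_le_mul h1 (e1.trans e2) (by positivity) (by positivity)
      _ = t ^ c := by rw [← Real.rpow_add ht]; ring_nf
  · have : 1 ≤ c / 8 * Real.log t := by
      rw [div_le_iff₀ hc] at h2
      linarith
    linarith

/-- Almost all prime tuples of shape `{0, P, …, kP}` consist of consecutive primes, if `k P` is at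
most a small power of `log x`. -/
theorem eventually_gapCount_multiples_ge {k : ℕ} (hk : 1 ≤ k) (hHL : UniformHardyLittlewood k)
    {ε : ℝ} (hε : 0 < ε) {c : ℝ} (hc : c = 1 / (4 * ((k : ℝ) + 2))) :
    ∀ᶠ x : ℝ in atTop, ∀ P : ℕ, 2 ≤ P → ((k * P : ℕ) : ℝ) ≤ Real.log x ^ c →
      1 ≤ singularSeries (insert 0 (multiples k P)) →
      (1 - 3 * ε) * (singularSeries (insert 0 (multiples k P)) * (x / Real.log x ^ (k + 1))) ≤
        gapCount k x (multiples k P) := by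
  have hc0 : 0 < c := by rw [hc]; positivity
  have ev1 : ∀ᶠ t : ℝ in atTop, t ^ ((k : ℝ) + 1 + c) * Real.exp (-1 * t) ≤ ε :=
    (tendsto_rpow_mul_exp_neg_mul_atTop_nhds_zero _ 1 one_pos).eventually_le_const hε
  filter_upwards [eventually_sum_primeTupleCount_le k hε, hHL ε hε,
    Real.tendsto_log_atTop.eventually (ev1.and (eventually_ge_atTop 1)), eventually_gt_atTop 0]
    with x hsum hHLx hlog hx0 P hP hkP hS
  rw [← hc] at hsum
  have h1 := hsum P (by omega) hkP
  obtain ⟨h2, h3⟩ := hlog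
  set t := Real.log x with ht
  have ht0 : 0 < t := by linarith
  have h4 := (abs_le.1 (hHLx (multiples k P) (card_multiples k (by omega)) (fun d hd => by
    obtain ⟨a, b⟩ := le_of_mem_multiples hd
    refine ⟨by omega, ?_⟩
    have b' : (d : ℝ) ≤ ((k * P : ℕ) : ℝ) := by exact_mod_cast b
    refine (b'.trans hkP).trans ?_
    rw [← Real.rpow_natCast]
    refine Real.rpow_le_rpow_of_exponent_le h3 ?_
    have hk0 : (0 : ℝ) ≤ k := Nat.cast_nonneg k
    have : c ≤ 1 := by rw [hc, div_le_one (by positivity)]; linarith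
    push_cast
    linarith) (by linarith))).1
  set S := singularSeries (insert 0 (multiples k P))
  have h5 : ((k * P : ℕ) : ℝ) ≤ ε * (x / t ^ (k + 1)) := by
    refine hkP.trans ?_
    rw [← mul_div_assoc, le_div_iff₀ (by positivity)]
    have hx : Real.exp t = x := Real.exp_log hx0
    have e1 : t ^ ((k : ℝ) + 1 + c) = t ^ c * t ^ (k + 1) := by
      rw [Real.rpow_add ht0, mul_comm, ← Real.rpow_natCast]; push_cast; rfl
    rw [e1, neg_one_mul, Real.exp_neg, hx, ← div_eq_mul_inv, div_le_iff₀ hx0] at h2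
    exact h2
  have h6 : (primeTupleCount x (insert 0 (multiples k P)) : ℝ) ≤
      gapCount k x (multiples k P) + ((k * P : ℕ) : ℝ) +
      ∑ e ∈ Finset.Icc (1 : ℤ) (k * P) \ multiples k P,
        (primeTupleCount x (insert e (insert 0 (multiples k P))) : ℝ) := by
    exact_mod_cast primeTupleCount_le_gapCount_add k (by omega : 0 < P) x
  have hX : 0 < x / t ^ (k + 1) := by positivity
  set X := x / t ^ (k + 1)
  have h7 : ε * X ≤ ε * (S * X) := by nlinarith [mul_pos hε hX]
  linarith

/-- A set which is a frequent difference pattern lies in the range in which the prime tuple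
conjecture is assumed, and has a nonzero singular series. -/
theorem bounds_of_lt_gapCount {k : ℕ} {x : ℝ} (hx0 : 0 < x) (ht0 : 0 < Real.log x)
    {D : Finset ℤ} (hD : D.card = k) (hgapk : ((k + 1 : ℕ) : ℝ) < gapCount k x D)
    (hkX : k * (x / Real.log x ^ (k + 1)) < gapCount k x D) :
    (0 : ℤ) ∉ D ∧ (∀ e ∈ D, 2 ≤ e ∧ (e : ℝ) ≤ Real.log x ^ (k + 1)) ∧
      singularSeries (insert 0 D) ≠ 0 := by
  set t := Real.log x
  have hpos := pos_of_mem_of_gapCount_pos (k := k) (x := x) (D := D) (by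
    have : (0 : ℝ) < gapCount k x D := lt_of_le_of_lt (by positivity) hgapk
    exact_mod_cast this)
  have h0D : (0 : ℤ) ∉ D := fun h => lt_irrefl (0 : ℤ) (hpos 0 h).1
  have hcard : (insert 0 D).card = k + 1 := by
    rw [Finset.card_insert_of_notMem h0D, hD]
  have hE0 : ∀ e ∈ insert 0 D, 0 ≤ e := by
    intro e he
    rcases Finset.mem_insert.1 he with rfl | he
    · exact le_rfl
    · exact (hpos e he).1.le
  have hadm : ∀ q : ℕ, q.Prime → residueCount (insert 0 D) q ≠ q := by
    intro q hq hqE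
    have h1 := primeTupleCount_le_card_of_residueCount_eq hE0 hq hqE x
    rw [hcard] at h1
    have h2 := (gapCount_le_primeTupleCount k x D).trans h1
    exact absurd hgapk (not_lt.2 (by exact_mod_cast h2))
  have hSne : singularSeries (insert 0 D) ≠ 0 := fun h => by
    obtain ⟨q, hq, hqE⟩ := exists_residueCount_eq_of_singularSeries_eq_zero h
    exact hadm q hq hqE
  -- an element beyond `log ^ (k + 1) x` makes the pattern too rare
  have hupper : ∀ e ∈ D, (e : ℝ) ≤ t ^ (k + 1) := by
    intro e he
    by_contra hcon
    have h1 := gapCount_mul_le hx0.le he (k := k)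
    have h2 : (gapCount k x D : ℝ) * t ^ (k + 1) ≤ k * x :=
      (mul_le_mul_of_nonneg_left (not_le.1 hcon).le (by positivity)).trans h1
    refine absurd hkX (not_lt.2 ?_)
    rw [← mul_div_assoc, le_div_iff₀ (by positivity)]
    exact h2
  -- with `0` and `1` both classes modulo `2` are occupied
  have hlower : ∀ e ∈ D, 2 ≤ e := by
    intro e he
    by_contra hcon
    have h1 : e = 1 := by have := (hpos e he).1; omega
    subst h1
    refine hadm 2 Nat.prime_two (le_antisymm (residueCount_le_self _ (by norm_num)) ?_)
    exact two_le_residueCount (Finset.mem_insert_self _ _) (Finset.mem_insert_of_mem he)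
      (by norm_num)
  exact ⟨h0D, fun e he => ⟨hlower e he, hupper e he⟩, hSne⟩

set_option maxHeartbeats 500000 in
theorem eventually_dvd_of_isChampion {k : ℕ} (hk : 1 ≤ k) (hHL : UniformHardyLittlewood k)
    {p : ℕ} (hp : p.Prime) :
    ∀ᶠ x : ℝ in atTop, ∀ D : Finset ℤ, IsChampion k x D → ∀ d ∈ D, (p : ℤ) ∣ d := by
  obtain ⟨T, hT0, hT⟩ := exists_hasProd_genericFactor (k + 1)
  have hp2 : (2 : ℝ) ≤ p := by exact_mod_cast hp.two_le
  set ρ : ℝ := (p - 2) / (p - 1) with hρ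
  have hρ0 : 0 ≤ ρ := div_nonneg (by linarith) (by linarith)
  have hρ1 : ρ < 1 := by rw [hρ, div_lt_one (by linarith)]; linarith
  -- this `ε` is small enough for `ρ (1 + ε) ^ 2 < 1 - 3 ε`
  set ε : ℝ := (1 - ρ) / 12 with hεdef
  have hε : 0 < ε := by rw [hεdef]; linarith
  have hε12 : ε ≤ 1 / 12 := by rw [hεdef]; linarith
  set c : ℝ := 1 / (4 * ((k : ℝ) + 2)) with hc
  have hc0 : 0 < c := by positivity
  set A : ℝ := 2 * k * ((k + 1) ^ 3 * (8 / c)) with hA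
  have hlogtop : Tendsto (fun n : ℕ => Real.log n) atTop atTop :=
    Real.tendsto_log_atTop.comp tendsto_natCast_atTop_atTop
  have hexp : ∀ᶠ n : ℕ in atTop, Real.exp (A / Real.log n) ≤ 1 + ε := by
    have h1 : Tendsto (fun n : ℕ => A / Real.log n) atTop (nhds 0) :=
      hlogtop.const_div_atTop A
    have h2 := (Real.continuous_exp.tendsto 0).comp h1
    rw [Real.exp_zero] at h2
    exact h2.eventually_le_const (by linarith)
  have hy : Tendsto (fun x : ℝ => ⌊c / 4 * Real.log (Real.log x)⌋₊) atTop atTop :=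
    tendsto_nat_floor_atTop.comp ((Real.tendsto_log_atTop.comp
      Real.tendsto_log_atTop).const_mul_atTop (by positivity))
  have evX : ∀ᶠ x : ℝ in atTop, 2 * ((k : ℝ) + 1) * Real.log x ^ (k + 1) ≤ x := by
    have h1 : (fun x : ℝ => Real.log x ^ (k + 1)) =o[atTop] fun x : ℝ => x :=
      Real.isLittleO_pow_log_id_atTop
    filter_upwards [h1.bound (show (0 : ℝ) < 1 / (2 * ((k : ℝ) + 1)) by positivity),
      eventually_ge_atTop 1] with x hx hx1
    rw [Real.norm_of_nonneg (pow_nonneg (Real.log_nonneg hx1) _),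
      Real.norm_of_nonneg (by linarith), one_div, inv_mul_eq_div,
      le_div_iff₀ (by positivity)] at hx
    linarith
  filter_upwards [hy.eventually (hexp.and ((eventually_ge_atTop (max (2 * (k + 1)) p)).and
      (hlogtop.eventually_ge_atTop (2 * k / T)))),
    eventually_primorial_bounds (k := k) hc0,
    eventually_gapCount_multiples_ge hk hHL hε hc, hHL ε hε, evX,
    Real.tendsto_log_atTop.eventually_gt_atTop 1, eventually_gt_atTop 0]
    with x hyx hbd hlow hHLx hXbig ht1 hx0 D hD d hd
  obtain ⟨hk1, hk2⟩ := hbd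
  set t := Real.log x with ht
  set y := ⌊c / 4 * Real.log t⌋₊ with hydef
  clear_value y
  obtain ⟨hy1, hy2, hy3⟩ := hyx
  have hky : 2 * (k + 1) ≤ y := (le_max_left _ _).trans hy2
  have hpy : p ≤ y := (le_max_right _ _).trans hy2
  have ht0 : 0 < t := by linarith
  set X := x / t ^ (k + 1) with hX
  have hX2 : 2 * ((k : ℝ) + 1) ≤ X := by rwa [hX, le_div_iff₀ (by positivity)]
  have hkR : (1 : ℝ) ≤ k := by exact_mod_cast hk
  have hX0 : 0 < X := by linarith
  set S₀ := singularSeries (insert 0 (multiples k (primorial y))) with hS₀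
  have hS2 : 2 * (k : ℝ) ≤ S₀ := by
    refine le_trans ?_ (mul_log_le_singularSeries_multiples hk (by omega) hT0 hT)
    rwa [div_le_iff₀' hT0] at hy3
  have hP2 : 2 ≤ primorial y := le_trans (by omega) le_primorial_self
  -- a champion occurs at least as often as the multiples of the primorial
  have hgap : (1 - 3 * ε) * (S₀ * X) ≤ gapCount k x D := by
    refine (hlow _ hP2 hk1 (by linarith)).trans ?_
    exact_mod_cast hD.2 _ (card_multiples k (by omega))
  have hgap' : 3 / 2 * k * X ≤ gapCount k x D := by
    refine le_trans ?_ hgap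
    have : 2 * k * X ≤ S₀ * X := mul_le_mul_of_nonneg_right hS2 hX0.le
    nlinarith [mul_pos (by linarith : (0 : ℝ) < S₀) hX0]
  have hgapk : ((k + 1 : ℕ) : ℝ) < gapCount k x D := by
    push_cast
    nlinarith
  have hkX : k * X < gapCount k x D := by
    nlinarith [mul_pos (by linarith : (0 : ℝ) < k) hX0]
  obtain ⟨h0D, hbounds, hSne⟩ := bounds_of_lt_gapCount hx0 (by linarith) hD.1 hgapk hkX
  have hle : (gapCount k x D : ℝ) ≤ primeTupleCount x (insert 0 D) := by
    exact_mod_cast gapCount_le_primeTupleCount k x D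
  have hHLD := (abs_le.1 (hHLx D hD.1 hbounds hSne)).2
  by_contra hpd
  have hB : (1 : ℝ) ≤ t ^ (k + 1) := one_le_pow₀ ht1.le
  have hbox : ∀ a ∈ (insert 0 D : Finset ℤ), (0 : ℝ) ≤ (a : ℝ) ∧ (a : ℝ) ≤ t ^ (k + 1) := by
    intro a ha
    rcases Finset.mem_insert.1 ha with rfl | ha
    · exact ⟨by simp, by push_cast; linarith⟩
    · obtain ⟨a1, a2⟩ := hbounds a ha
      exact ⟨by exact_mod_cast (by omega : (0 : ℤ) ≤ a), a2⟩
  -- all distances between elements of `{0} ∪ D` are at most `log ^ (k + 1) x`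
  have hmain := singularSeries_le_of_not_dvd hky hp hpy hD.1 h0D hd hpd hB (fun a ha b hb => by
    obtain ⟨a1, a2⟩ := hbox a ha
    obtain ⟨b1, b2⟩ := hbox b hb
    push_cast
    rw [abs_le]
    constructor <;> linarith)
  have hlt : 0 < Real.log t := Real.log_pos ht1
  have hy0 : (1 : ℝ) < y := by exact_mod_cast (by omega : 1 < y)
  have hlogy : 0 < Real.log y := Real.log_pos hy0
  have hE : Real.exp (2 * k * ((k + 1) ^ 2 * Real.log (t ^ (k + 1)) / (y * Real.log y))) ≤
      1 + ε := by
    refine le_trans (Real.exp_le_exp.2 ?_) hy1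
    rw [Real.log_pow, hA, mul_div_assoc (2 * (k : ℝ))]
    refine mul_le_mul_of_nonneg_left ?_ (by positivity)
    rw [div_le_div_iff₀ (by positivity) hlogy]
    have e1 : Real.log t ≤ 8 / c * y := by
      rw [div_mul_eq_mul_div, le_div_iff₀ hc0]
      linarith
    push_cast
    calc ((k : ℝ) + 1) ^ 2 * ((k + 1) * Real.log t) * Real.log y
        = (k + 1) ^ 3 * Real.log t * Real.log y := by ring
      _ ≤ (k + 1) ^ 3 * (8 / c * y) * Real.log y := by gcongr
      _ = _ := by ring
  rw [← hρ] at hmain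
  have hS0 : 0 < S₀ := by linarith
  have h1 : singularSeries (insert 0 D) ≤ ρ * (1 + ε) * S₀ :=
    hmain.trans (by gcongr)
  have h2 : (gapCount k x D : ℝ) ≤ (1 + ε) * (ρ * (1 + ε) * S₀ * X) := by
    have h3 : singularSeries (insert 0 D) * X ≤ ρ * (1 + ε) * S₀ * X :=
      mul_le_mul_of_nonneg_right h1 hX0.le
    calc (gapCount k x D : ℝ) ≤ (1 + ε) * (singularSeries (insert 0 D) * X) := by linarith
      _ ≤ _ := by gcongr
  have h3 : (1 + ε) * (ρ * (1 + ε)) < 1 - 3 * ε := by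
    have e1 : ρ = 1 - 12 * ε := by rw [hεdef]; ring
    rw [e1]
    nlinarith [pow_pos hε 3]
  have h4 := mul_lt_mul_of_pos_right h3 (mul_pos hS0 hX0)
  linarith

/-- As soon as `x` is at least the prime with index `k`, some pattern occurs. -/
theorem eventually_gapCount_pos_of_isChampion (k : ℕ) :
    ∀ᶠ x : ℝ in atTop, ∀ D : Finset ℤ, IsChampion k x D → 0 < gapCount k x D := by
  filter_upwards [eventually_ge_atTop (Nat.nth Nat.Prime k : ℝ)] with x hx D hD
  have hcard : ((Finset.Icc 1 k).image fun i =>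
      (Nat.nth Nat.Prime (0 + i) : ℤ) - (Nat.nth Nat.Prime 0 : ℤ)).card = k := by
    rw [Finset.card_image_of_injective _ fun i j hij => ?_]
    · simp
    · have h1 : (Nat.nth Nat.Prime (0 + i) : ℤ) = Nat.nth Nat.Prime (0 + j) :=
        sub_left_injective hij
      have := nth_prime_strictMono.injective (by exact_mod_cast h1)
      omega
  refine lt_of_lt_of_le ?_ (hD.2 _ hcard)
  exact (Set.ncard_pos (finite_gapSet _ _ _)).2 ⟨0, by simpa using hx, rfl⟩

theorem le_gcd_of_forall_dvd {D : Finset ℤ} (hne : D.Nonempty) (hpos : ∀ d ∈ D, 0 < d) {n : ℤ}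
    (h : ∀ d ∈ D, n ∣ d) : n ≤ D.gcd id := by
  refine Int.le_of_dvd (lt_of_le_of_ne ?_ fun h0 => ?_) (Finset.dvd_gcd h)
  · exact Int.nonneg_of_normalize_eq_self Finset.normalize_gcd
  · obtain ⟨d, hd⟩ := hne
    exact (hpos d hd).ne' (Finset.gcd_eq_zero_iff.1 h0.symm d hd)

end JumpingChampion

theorem theoremC1 (k : ℕ) (hk : 1 ≤ k)
    (hHL : JumpingChampion.UniformHardyLittlewood k) :
    -- the gcd of the elements of the champions tends to infinity
    (∀ M : ℤ, ∀ᶠ x : ℝ in atTop, ∀ D : Finset ℤ,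
      JumpingChampion.IsChampion k x D → M ≤ D.gcd id) ∧
    -- every fixed prime divides every element of the champions for `x` sufficiently large
    (∀ p : ℕ, p.Prime → ∀ᶠ x : ℝ in atTop, ∀ D : Finset ℤ,
      JumpingChampion.IsChampion k x D → ∀ d ∈ D, (p : ℤ) ∣ d) ∧
    -- every fixed prime divides every element of each champion, for whatever `x`, which occurs
    -- at all and whose largest element is sufficiently large
    (∀ p : ℕ, p.Prime → ∃ C : ℤ, ∀ (x : ℝ) (D : Finset ℤ),
      JumpingChampion.IsChampion k x D → 0 < JumpingChampion.gapCount k x D →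
        (∃ d ∈ D, C ≤ d) → ∀ d ∈ D, (p : ℤ) ∣ d) := by
  refine ⟨fun M => ?_, fun p hp => JumpingChampion.eventually_dvd_of_isChampion hk hHL hp,
    fun p hp => ?_⟩
  · obtain ⟨p, hMp, hp⟩ := Nat.exists_infinite_primes M.toNat
    filter_upwards [JumpingChampion.eventually_dvd_of_isChampion hk hHL hp,
      JumpingChampion.eventually_gapCount_pos_of_isChampion k] with x hdvd hpos D hD
    have hne : D.Nonempty := Finset.card_pos.1 (by rw [hD.1]; omega)
    refine le_trans (by omega) (JumpingChampion.le_gcd_of_forall_dvd hne (fun d hd =>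
      (JumpingChampion.pos_of_mem_of_gapCount_pos (hpos D hD) d hd).1) (hdvd D hD))
  · obtain ⟨X, hX⟩ := eventually_atTop.1
      (JumpingChampion.eventually_dvd_of_isChampion hk hHL hp)
    refine ⟨⌈X⌉, fun x D hD hpos hC => hX x ?_ D hD⟩
    -- an occurring champion with an element `e` forces `e ≤ x`
    obtain ⟨e, he, hCe⟩ := hC
    exact (Int.ceil_le.1 hCe).trans (JumpingChampion.pos_of_mem_of_gapCount_pos hpos e he).2
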